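/- **Setting.** For $v\in\mathbb R^3$ put $\langle v\rangle=(1+|v|^2)^{1/2}$, and let $L^1_2(\mathbb R^3)$ be the set of $f\in L^1(\mathbb R^3)$ with $\int\langle v\rangle^2|f(v)|\,dv<\infty$. Put $H(f)=\int f\log f\,dv$ and, for $\varepsilon>0$ and $0\le f\le\varepsilon^{-1}$, $$\mathcal S_\varepsilon(f)=-\frac1\varepsilon\int_{\mathbb R^3}\big[\varepsilon f\log(\varepsilon f)+(1-\varepsilon f)\log(1-\varepsilon f)\big]\,dv .$$ For $\gamma\in\mathbb R$ and $0\le g\le \varepsilon^{-1}$ the entropy production is $$\mathscr D_\varepsilon(g)=\frac12\iint_{\mathbb R^3\times\mathbb R^3}|v-w|^{\gamma+2}\,F(v)F(w)\left|\Pi(v-w)\Big(\frac{\nabla g(v)}{F(v)}-\frac{\nabla g(w)}{F(w)}\Big)\right|^2dv\,dw\in[0,\infty],\qquad F=g(1-\varepsilon g),$$ where $\Pi(z)$ is the orthogonal projection on $(\mathbb R z)^\perp$, $\nabla g$ is the weak gradient, and the integrand is $0$ where $F(v)F(w)=0$; $\mathscr D_\varepsilon(g)=\infty$ if $g$ has no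 locally integrable weak gradient. Likewise $\int|\nabla\sqrt g|^2\langle v\rangle^\gamma dv$ is understood with the weak gradient of $\sqrt g$, and as $\infty$ if there is no locally integrable one. Fix $\varepsilon_0>0$. An initial datum is a function $0\le f_{\rm in}\in L^1_2(\mathbb R^3)$ with $$\|f_{\rm in}\|_\infty=\varepsilon_0^{-1},\qquad \mathcal S_{\varepsilon_0}(f_{\rm in})>0,\qquad |H(f_{\rm in})|<\infty,$$ normalized by $\int f_{\rm in}\,dv=1$, $\int f_{\rm in}\,v\,dv=0$, $\int f_{\rm in}|v|^2dv=3$. For $\varepsilon\in(0,\varepsilon_0]$, $\mathcal Y_\varepsilon(f_{\rm in})$ is the set of $g\in L^1_2(\mathbb R^3)$ with $0\le g\le\varepsilon^{-1}$, with the same mass, momentum and energy as $f_{\rm in}$ (that is, $\int g\,dv=1$, $\int g\,v\,dv=0$, $\int g|v|^2dv=3$), and with $\mathcal S_\varepsilon(g)\ge\mathcal S_\varepsilon(f_{\rm in})$. **Theorem 1.8.** Let $\varepsilon_0>0$ be fixed and let $\gamma<0$. For every initial datum $f_{\rm in}$ as above there is a constant $C_0(\gamma)>0$, depending only on $\gamma$,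 $H(f_{\rm in})$ and the fixed number $\varepsilon_0$, such that $$\int_{\mathbb R^3}\big|\nabla\sqrt{g(v)}\big|^2\langle v\rangle^\gamma\,dv\le C_0(\gamma)\,\big(1+\mathscr D_\varepsilon(g)\big)\qquad\text{for all }\varepsilon\in(0,\varepsilon_0]\text{ and all }g\in\mathcal Y_\varepsilon(f_{\rm in}).$$ -/

import Mathlib

open MeasureTheory

noncomputable section

namespace LFD

/-- Velocity space `ℝ³` with its Euclidean norm and Lebesgue measure. -/
abbrev V : Type := EuclideanSpace ℝ (Fin 3)

/-- The Japanese bracket `⟨v⟩ = (1 + |v|²)^{1/2}`. -/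
def bracket (v : V) : ℝ := Real.sqrt (1 + ‖v‖ ^ 2)

/-- Membership in `L¹_s(ℝ³)`: `f` is integrable and `∫ ⟨v⟩^s |f(v)| dv < ∞`. -/
def MemL1 (s : ℝ) (f : V → ℝ) : Prop :=
  Integrable f volume ∧ Integrable (fun v => bracket v ^ s * |f v|) volume

/-- The Boltzmann entropy `H(f) = ∫ f log f dv` (with `0 log 0 = 0`). -/
def boltzmannH (f : V → ℝ) : ℝ := ∫ v, f v * Real.log (f v)

/-- The Fermi-Dirac entropy
`S_ε(f) = -ε⁻¹ ∫ [ε f log (ε f) + (1 - ε f) log (1 - ε f)] dv`. -/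
def fermiDiracS (ε : ℝ) (f : V → ℝ) : ℝ :=
  -ε⁻¹ * ∫ v, (ε * f v * Real.log (ε * f v) + (1 - ε * f v) * Real.log (1 - ε * f v))

/-- The standing assumptions on the initial datum: `0 ≤ f ∈ L¹₂`, `‖f‖_∞ = ε₀⁻¹`,
`S_{ε₀}(f) > 0`, and `f log f` is integrable (that is, `|H(f)| < ∞`). -/
structure IsInitialDatum (ε₀ : ℝ) (f : V → ℝ) : Prop where
  nonneg : ∀ᵐ v, 0 ≤ f v
  memL1 : MemL1 2 f
  norm_eq : eLpNorm f ⊤ volume = ENNReal.ofReal ε₀⁻¹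
  entropy_pos : 0 < fermiDiracS ε₀ f
  integrable_log : Integrable (fun v => f v * Real.log (f v)) volume

/-- The normalization `ϱ = 1`, `u = 0`, `E = 1`: unit mass, zero momentum, energy `3`. -/
structure IsNormalized (f : V → ℝ) : Prop where
  mass : ∫ v, f v = 1
  momentum : ∫ v, f v • v = 0
  energy : ∫ v, f v * ‖v‖ ^ 2 = 3

/-- The class `Y_ε(f_in)`: functions in `L¹₂` with `0 ≤ f ≤ ε⁻¹`, with the same mass, momentum and
energy as `f_in`, and with `S_ε(f) ≥ S_ε(f_in)`. -/
structure ClassY (ε : ℝ) (fin f : V → ℝ) : Prop where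
  memL1 : MemL1 2 f
  nonneg : ∀ᵐ v, 0 ≤ f v
  le_inv : ∀ᵐ v, f v ≤ ε⁻¹
  mass : ∫ v, f v = ∫ v, fin v
  momentum : ∫ v, f v • v = ∫ v, fin v • v
  energy : ∫ v, f v * ‖v‖ ^ 2 = ∫ v, fin v * ‖v‖ ^ 2
  entropy : fermiDiracS ε fin ≤ fermiDiracS ε f

/-- `G` is the weak (distributional) gradient of `u`, both being locally integrable.
Such a `G` is unique up to a null set. -/
structure IsWeakGradient (u : V → ℝ) (G : V → V) : Prop where
  locInt : LocallyIntegrable u volume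
  locInt_grad : LocallyIntegrable G volume
  integral_eq : ∀ φ : V → ℝ, ContDiff ℝ (⊤ : ℕ∞) φ → HasCompactSupport φ → ∀ e : V,
    ∫ v, u v * fderiv ℝ φ v e = -∫ v, inner ℝ (G v) e * φ v

/-- `Π(z) x = x - (z · x) z / |z|²`, the orthogonal projection of `x` on `(ℝ z)^⊥`. -/
def orthProj (z x : V) : V := x - (inner ℝ z x / ‖z‖ ^ 2) • z

/-- The kinetic potential `Ψ(z) = |z|^{γ+2}`. -/
def kineticPotential (γ : ℝ) (z : V) : ℝ := ‖z‖ ^ (γ + 2)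

/-- `Ξ_ε[g](v, w) = F(v) F(w) |Π(v - w) (∇g(v) / F(v) - ∇g(w) / F(w))|²` with
`F = g (1 - ε g)` and `∇g = G`; it is `0` where `F(v) F(w) = 0`. -/
def Xi (ε : ℝ) (g : V → ℝ) (G : V → V) (v w : V) : ℝ :=
  g v * g w * (1 - ε * g v) * (1 - ε * g w) *
    ‖orthProj (v - w)
      ((g v * (1 - ε * g v))⁻¹ • G v - (g w * (1 - ε * g w))⁻¹ • G w)‖ ^ 2

/-- The entropy production `D_ε(g) = ½ ∬ Ψ(v - w) Ξ_ε[g](v, w) dv dw ∈ [0, ∞]`, the gradient in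
`Ξ_ε[g]` being the weak one. The infimum is over the weak gradients of `g`, which are all equal
almost everywhere; it is `∞` when `g` has no locally integrable weak gradient. -/
def entropyProduction (γ ε : ℝ) (g : V → ℝ) : ENNReal :=
  ⨅ (G : V → V) (_ : IsWeakGradient g G),
    (1 / 2 : ENNReal) *
      ∫⁻ p : V × V, ENNReal.ofReal (kineticPotential γ (p.1 - p.2) * Xi ε g G p.1 p.2)

/-- The weighted Fisher information `∫ |∇√g|² ⟨v⟩^γ dv ∈ [0, ∞]`, with the weak gradient of `√g`;
it is `∞` when `√g` has no locally integrable weak gradient. -/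
def fisherInformation (γ : ℝ) (g : V → ℝ) : ENNReal :=
  ⨅ (G : V → V) (_ : IsWeakGradient (fun v => Real.sqrt (g v)) G),
    ∫⁻ v, ENNReal.ofReal (‖G v‖ ^ 2 * bracket v ^ γ)

end LFD

end

noncomputable section

namespace LFD

open Filter Topology Metric Convolution

/-! The entropy forces `F = g (1 - ε g)` to be spread out, uniformly in `ε`. This spreading makes
the degenerate projection `Π(v - w)` coercive once it is averaged over `w`, and an integration by
parts in `w` then bounds `∇g(v) / F(v)` pointwise.

Entropy. Put `s₀ = log ε₀⁻¹ - H(f_in)`. It is positive: otherwise `f_in` would take only the values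
`0` and `ε₀⁻¹`, where the Fermi-Dirac entropy vanishes (`IsInitialDatum.boltzmannH_lt`). Every `g`
in the class has `S_ε(g) - log (ε₀ / ε) ≥ s₀` (`ClassY.hasEntropyBound`). The density of the left
side is at most `C F^(3/4)` with `C` independent of `ε` (`entropyDensity_le`), so `F` keeps a fixed
mass in a fixed ball away from any thin slab (`exists_mass_off_slabs`).

Coercivity. Fix `v` and put `z = v - w`, `x = ∇g(v) / F(v) = l u` with `|u| = 1`, `k = ∇g(w) /
F(w)`. Then `|z|² |Π(z)(x - k)|² ≥ |z|² |Π(z)x|² - 2 k · |z|² Π(z)x`. After multiplication by `F(w)`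
and a cutoff, `F k` becomes `∇g(w)`, and the cross term can be integrated by parts because `|z|²
Π(z)x` is polynomial in `w`. With `A` the distance from `v` to the line `ℝu`, the first term gives
at least `c₁ l² (1 + A)²`, while the cross integral is at most a constant times `l (1 + |v|)(1 +
A)`. Absorbing `l (1 + A)` leaves `l² ≤ C (1 + |v|² + J(v))`, with `J` the local production
(`exists_norm_sq_le`): the growth in `v` is just what the energy controls.

Conclusion. Multiply by `F(v) ⟨v⟩^γ` and integrate. Since `F ≤ g`, the left side dominates `|∇√g|²
⟨v⟩^γ`; mass and energy bound the first term, and the production bounds the second, because `⟨v⟩^γ`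
is at most a constant times `|v - w|^γ` for bounded `w` and `γ < 0`. Mollification supplies the
calculus of weak gradients this needs: they vanish on level sets, and `∇√g = ∇g / (2√g)`. -/

/-! ### Mollification -/

/-- A sequence of bump functions concentrating at the origin. -/
def bump (n : ℕ) : ContDiffBump (0 : V) where
  rIn := 1 / (n + 2 : ℝ)
  rOut := 2 / (n + 2 : ℝ)
  rIn_pos := by positivity
  rIn_lt_rOut := by gcongr; norm_num

/-- The kernel of the mollification. -/
def ker (n : ℕ) : V → ℝ := (bump n).normed volume

/-- Mollification of a function. -/
def mol (n : ℕ) (f : V → ℝ) : V → ℝ := ker n ⋆[ContinuousLinearMap.lsmul ℝ ℝ, volume] f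

theorem bump_rOut_le (n : ℕ) : (bump n).rOut ≤ 1 := by
  change 2 / (n + 2 : ℝ) ≤ 1
  rw [div_le_one (by positivity)]
  have : (0 : ℝ) ≤ n := by positivity
  linarith

theorem bump_rOut_tendsto : Tendsto (fun n => (bump n).rOut) atTop (𝓝 0) := by
  change Tendsto (fun n : ℕ => 2 / (n + 2 : ℝ)) atTop (𝓝 0)
  refine Tendsto.div_atTop tendsto_const_nhds ?_
  exact tendsto_atTop_add_const_right _ _ tendsto_natCast_atTop_atTop

theorem ker_contDiff (n : ℕ) : ContDiff ℝ (⊤ : ℕ∞) (ker n) := (bump n).contDiff_normed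

theorem ker_hasCompactSupport (n : ℕ) : HasCompactSupport (ker n) :=
  (bump n).hasCompactSupport_normed

theorem ker_integrable (n : ℕ) : Integrable (ker n) := (bump n).integrable_normed

theorem ker_eq_zero {n : ℕ} {x : V} (hx : 1 ≤ ‖x‖) : ker n x = 0 := by
  have h : x ∉ Function.support (ker n) := by
    unfold ker
    rw [(bump n).support_normed_eq]
    simp only [mem_ball, dist_zero_right, not_lt]
    exact (bump_rOut_le n).trans hx
  simpa using h

theorem mol_apply (n : ℕ) (f : V → ℝ) (x : V) : mol n f x = ∫ t, ker n t * f (x - t) := by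
  simp [mol, convolution_def]

theorem mol_apply_swap (n : ℕ) (f : V → ℝ) (x : V) : mol n f x = ∫ t, ker n (x - t) * f t := by
  simp [mol, convolution_eq_swap]

theorem mol_tendsto_ae {f : V → ℝ} (hf : LocallyIntegrable f) :
    ∀ᵐ x, Tendsto (fun n => mol n f x) atTop (𝓝 (f x)) := by
  refine ContDiffBump.ae_convolution_tendsto_right_of_locallyIntegrable (K := 2)
    bump_rOut_tendsto (Eventually.of_forall fun n => ?_) hf
  change 2 / (n + 2 : ℝ) ≤ 2 * (1 / (n + 2 : ℝ))
  exact le_of_eq (by ring)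

theorem mol_integrable (n : ℕ) {f : V → ℝ} (hf : Integrable f) : Integrable (mol n f) :=
  (ker_integrable n).integrable_convolution _ hf

theorem integral_mol (n : ℕ) {f : V → ℝ} (hf : Integrable f) : ∫ x, mol n f x = ∫ x, f x := by
  have := integral_convolution (ContinuousLinearMap.lsmul ℝ ℝ) (ker_integrable n) hf
  unfold mol
  rw [this]
  have h1 : ∫ x, ker n x = 1 := (bump n).integral_normed
  simp [h1]

theorem mol_nonneg (n : ℕ) {f : V → ℝ} (hf : ∀ x, 0 ≤ f x) (x : V) : 0 ≤ mol n f x := by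
  rw [mol_apply]
  exact integral_nonneg fun t => mul_nonneg ((bump n).nonneg_normed t) (hf _)

/-- Scheffé's argument: mollification preserves the integral, so the `L¹` distance is twice the
integral of the positive part of `f - mol n f`. That part is dominated by `f` because `mol n f ≥ 0`.
-/
theorem mol_tendsto_L1_of_nonneg {f : V → ℝ} (hf : Integrable f) (h0 : ∀ x, 0 ≤ f x) :
    Tendsto (fun n => ∫ x, |mol n f x - f x|) atTop (𝓝 0) := by
  have key : ∀ n, ∫ x, |mol n f x - f x| = 2 * ∫ x, max (f x - mol n f x) 0 := by
    intro n
    have hs : Integrable (fun x => f x - mol n f x) := hf.sub (mol_integrable n hf)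
    have h1 : ∀ x, |mol n f x - f x| =
        2 * max (f x - mol n f x) 0 - (f x - mol n f x) := by
      intro x
      rcases le_total (f x - mol n f x) 0 with h | h
      · rw [max_eq_right h, abs_of_nonneg (by linarith)]; ring
      · rw [max_eq_left h, abs_of_nonpos (by linarith)]; ring
    simp_rw [h1]
    rw [integral_sub (hs.pos_part.const_mul 2) hs, integral_const_mul,
      integral_sub hf (mol_integrable n hf), integral_mol n hf]
    ring
  simp_rw [key]
  have : Tendsto (fun n => ∫ x, max (f x - mol n f x) 0) atTop (𝓝 (∫ _ : V, (0 : ℝ))) := by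
    refine tendsto_integral_of_dominated_convergence f ?_ hf ?_ ?_
    · exact fun n => (hf.sub (mol_integrable n hf)).pos_part.aestronglyMeasurable
    · refine fun n => Eventually.of_forall fun x => ?_
      rw [Real.norm_of_nonneg (le_max_right _ _)]
      exact max_le (by linarith [mol_nonneg n h0 x]) (h0 x)
    · filter_upwards [mol_tendsto_ae hf.locallyIntegrable] with x hx
      have := (tendsto_const_nhds (x := f x)).sub hx
      simpa using this.max (tendsto_const_nhds (x := (0 : ℝ)))
  simpa using this.const_mul 2

theorem mol_sub (n : ℕ) {f g : V → ℝ} (hf : LocallyIntegrable f) (hg : LocallyIntegrable g)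
    (x : V) : mol n (fun y => f y - g y) x = mol n f x - mol n g x := by
  have h : ∀ {f : V → ℝ}, LocallyIntegrable f → Integrable fun t => ker n (x - t) * f t := by
    intro f hf
    refine hf.integrable_smul_left_of_hasCompactSupport
      ((ker_contDiff n).continuous.comp (continuous_const.sub continuous_id)) ?_
    exact (ker_hasCompactSupport n).comp_homeomorph (Homeomorph.subLeft x)
  simp_rw [mol_apply_swap, mul_sub]
  exact integral_sub (h hf) (h hg)

theorem mol_tendsto_L1 {f : V → ℝ} (hf : Integrable f) :
    Tendsto (fun n => ∫ x, |mol n f x - f x|) atTop (𝓝 0) := by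
  have hp := hf.pos_part
  have hm := hf.neg_part
  have h := (mol_tendsto_L1_of_nonneg hp fun x => le_max_right _ _).add
    (mol_tendsto_L1_of_nonneg hm fun x => le_max_right _ _)
  rw [add_zero] at h
  refine squeeze_zero (fun n => integral_nonneg fun x => abs_nonneg _) (fun n => ?_) h
  have hp' : Integrable fun x => |mol n (fun y => max (f y) 0) x - max (f x) 0| :=
    ((mol_integrable n hp).sub hp).abs
  have hm' : Integrable fun x => |mol n (fun y => max (-f y) 0) x - max (-f x) 0| :=
    ((mol_integrable n hm).sub hm).abs
  rw [← integral_add hp' hm']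
  refine integral_mono ((mol_integrable n hf).sub hf).abs (hp'.add hm') fun x => ?_
  have e : f = fun y => max (f y) 0 - max (-f y) 0 := by
    funext y
    rcases le_total (f y) 0 with h | h
    · rw [max_eq_right h, max_eq_left (by linarith)]; ring
    · rw [max_eq_left h, max_eq_right (by linarith)]; ring
  have e1 : mol n f x = mol n (fun y => max (f y) 0) x - mol n (fun y => max (-f y) 0) x := by
    conv_lhs => rw [e]
    exact mol_sub n hp.locallyIntegrable hm.locallyIntegrable x
  have e2 : f x = max (f x) 0 - max (-f x) 0 := congrFun e x
  have e3 : mol n f x - f x = (mol n (fun y => max (f y) 0) x - max (f x) 0) -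
      (mol n (fun y => max (-f y) 0) x - max (-f x) 0) := by
    rw [e1]; linarith
  change |mol n f x - f x| ≤ _
  rw [e3]
  exact abs_sub _ _

/-- The kernels live in the unit ball, so on `K` the mollification only sees `f` on the 1-thickening
of `K`. Truncating there reduces to the integrable case. -/
theorem mol_tendsto_L1_on {f : V → ℝ} (hf : LocallyIntegrable f) {K : Set V} (hK : IsCompact K) :
    Tendsto (fun n => ∫ x in K, |mol n f x - f x|) atTop (𝓝 0) := by
  have hK' : IsCompact (cthickening 1 K) := hK.cthickening
  set f' := (cthickening 1 K).indicator f with hf'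
  have hi : Integrable f' := by
    rw [hf', integrable_indicator_iff hK'.measurableSet]
    exact hf.integrableOn_isCompact hK'
  refine squeeze_zero (fun n => integral_nonneg fun x => abs_nonneg _) (fun n => ?_)
    (mol_tendsto_L1 hi)
  have hint : Integrable fun x => |mol n f' x - f' x| := ((mol_integrable n hi).sub hi).abs
  refine le_trans (le_of_eq ?_) (setIntegral_le_integral (s := K) hint
    (Eventually.of_forall fun x => abs_nonneg _))
  refine setIntegral_congr_fun hK.measurableSet fun x hx => ?_
  have hmem : ∀ t : V, ‖t‖ ≤ 1 → f' (x - t) = f (x - t) := by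
    intro t ht
    refine Set.indicator_of_mem (mem_cthickening_of_dist_le _ x _ _ hx ?_) _
    simpa [dist_eq_norm] using ht
  have e1 : f' x = f x := by simpa using hmem 0 (by simp)
  have e2 : mol n f' x = mol n f x := by
    simp_rw [mol_apply]
    congr 1
    funext t
    rcases le_total ‖t‖ 1 with h | h
    · rw [hmem t h]
    · rw [ker_eq_zero h]; simp
  simp only [e1, e2]

theorem mol_contDiff (n : ℕ) {f : V → ℝ} (hf : LocallyIntegrable f) : ContDiff ℝ 1 (mol n f) :=
  (ker_hasCompactSupport n).contDiff_convolution_left _ ((ker_contDiff n).of_le (by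
    exact_mod_cast le_top)) hf

/-- The derivative falls on the kernel, and `ker n (x - ·)` is an admissible test function in the
definition of the weak gradient. -/
theorem fderiv_mol (n : ℕ) {u : V → ℝ} {G : V → V} (h : IsWeakGradient u G) (x e : V) :
    fderiv ℝ (mol n u) x e = mol n (fun v => inner ℝ (G v) e) x := by
  have hk1 : ContDiff ℝ 1 (ker n) := (ker_contDiff n).of_le (by exact_mod_cast le_top)
  have h1 := (ker_hasCompactSupport n).hasFDerivAt_convolution_left
    (ContinuousLinearMap.lsmul ℝ ℝ) hk1 h.locInt x
  have hcts : Continuous fun t : V => x - t := continuous_const.sub continuous_id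
  have hcs : HasCompactSupport fun t => ker n (x - t) :=
    (ker_hasCompactSupport n).comp_homeomorph (Homeomorph.subLeft x)
  have h2 : ∀ t, fderiv ℝ (fun t => ker n (x - t)) t e = -fderiv ℝ (ker n) (x - t) e := by
    intro t
    have hd : HasFDerivAt (fun t => ker n (x - t))
        ((fderiv ℝ (ker n) (x - t)).comp (-ContinuousLinearMap.id ℝ V)) t := by
      refine HasFDerivAt.comp t (hk1.differentiable one_ne_zero _).hasFDerivAt ?_
      exact (hasFDerivAt_id t).const_sub x
    rw [hd.fderiv]
    simp
  have h3 := h.integral_eq (fun t => ker n (x - t))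
    ((ker_contDiff n).comp (contDiff_const.sub contDiff_id)) hcs e
  have h4 : fderiv ℝ (mol n u) x = _ := h1.fderiv
  rw [h4, convolution_eq_swap, ContinuousLinearMap.integral_apply]
  · simp only [ContinuousLinearMap.precompL_apply, ContinuousLinearMap.lsmul_apply, smul_eq_mul]
    simp_rw [h2] at h3
    rw [mol_apply_swap]
    have e1 : ∀ t, u t * -(fderiv ℝ (ker n) (x - t)) e =
        -((fderiv ℝ (ker n) (x - t)) e * u t) := fun t => by ring
    simp_rw [e1, integral_neg, neg_inj] at h3
    rw [h3]
    congr 1; funext t; ring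
  · have hc : Continuous fun t => fderiv ℝ (ker n) (x - t) :=
      (hk1.continuous_fderiv one_ne_zero).comp hcts
    have hc2 : HasCompactSupport fun t => fderiv ℝ (ker n) (x - t) :=
      ((ker_hasCompactSupport n).fderiv ℝ).comp_homeomorph (Homeomorph.subLeft x)
    have := h.locInt.integrable_smul_right_of_hasCompactSupport hc hc2
    refine this.congr (Eventually.of_forall fun t => ?_)
    ext e'
    simp [ContinuousLinearMap.precompL_apply, mul_comm]

/-- Products of `L¹_loc`-convergent mollifications with bounded, compactly supported,
a.e. convergent multipliers. -/
theorem tendsto_integral_mul_mol {f : V → ℝ} (hf : LocallyIntegrable f) {K : Set V}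
    (hK : IsCompact K) {w : ℕ → V → ℝ} {w' : V → ℝ} {C : ℝ}
    (hw : ∀ n, AEStronglyMeasurable (w n) volume) (hC : ∀ n x, |w n x| ≤ C)
    (h0 : ∀ n, ∀ x ∉ K, w n x = 0) (hlim : ∀ᵐ x, Tendsto (fun n => w n x) atTop (𝓝 (w' x))) :
    Tendsto (fun n => ∫ x, w n x * mol n f x) atTop (𝓝 (∫ x, w' x * f x)) := by
  have hwi : ∀ n (h : V → ℝ), LocallyIntegrable h → Integrable fun x => w n x * h x := by
    intro n h hh
    have h1 : IntegrableOn (fun x => w n x * h x) K := by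
      refine (hh.integrableOn_isCompact hK).bdd_mul (c := C) (hw n).restrict ?_
      exact Eventually.of_forall fun x => hC n x
    refine (integrable_indicator_iff hK.measurableSet).2 h1 |>.congr ?_
    refine Eventually.of_forall fun x => ?_
    by_cases hx : x ∈ K
    · simp [hx]
    · simp [hx, h0 n x hx]
  have hmol : ∀ n, LocallyIntegrable (mol n f) := fun n =>
    (mol_contDiff n hf).continuous.locallyIntegrable
  have h1 : Tendsto (fun n => ∫ x, w n x * f x) atTop (𝓝 (∫ x, w' x * f x)) := by
    refine tendsto_integral_of_dominated_convergence (K.indicator fun x => C * |f x|)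
      (fun n => (hwi n f hf).aestronglyMeasurable) ?_ ?_ ?_
    · rw [integrable_indicator_iff hK.measurableSet]
      exact (hf.integrableOn_isCompact hK).abs.const_mul C
    · refine fun n => Eventually.of_forall fun x => ?_
      by_cases hx : x ∈ K
      · simp only [hx, Set.indicator_of_mem, norm_mul, Real.norm_eq_abs]
        exact mul_le_mul_of_nonneg_right (hC n x) (abs_nonneg _)
      · simp [hx, h0 n x hx]
    · filter_upwards [hlim] with x hx
      exact hx.mul_const _
  have h2 : Tendsto (fun n => ∫ x, w n x * (mol n f x - f x)) atTop (𝓝 0) := by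
    rw [tendsto_zero_iff_norm_tendsto_zero]
    have h3 := (mol_tendsto_L1_on hf hK).const_mul C
    rw [mul_zero] at h3
    refine squeeze_zero (fun n => norm_nonneg _) (fun n => ?_) h3
    rw [← integral_const_mul, ← integral_indicator hK.measurableSet]
    refine norm_integral_le_of_norm_le ?_ (Eventually.of_forall fun x => ?_)
    · rw [integrable_indicator_iff hK.measurableSet]
      exact ((((hmol n).sub hf).integrableOn_isCompact hK).abs).const_mul C
    · by_cases hx : x ∈ K
      · simp only [hx, Set.indicator_of_mem, norm_mul, Real.norm_eq_abs]
        exact mul_le_mul_of_nonneg_right (hC n x) (abs_nonneg _)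
      · simp [hx, h0 n x hx]
  have h3 := h2.add h1
  rw [zero_add] at h3
  refine h3.congr fun n => ?_
  have hd : Integrable fun x => w n x * (mol n f x - f x) := hwi n _ ((hmol n).sub hf)
  rw [← integral_add hd (hwi n f hf)]
  congr 1; funext x; ring

/-! ### Chain rule for weak gradients, level sets, square roots -/

theorem abs_fderiv_apply_le {φ : V → ℝ} (hφ : ContDiff ℝ (⊤ : ℕ∞) φ) (hc : HasCompactSupport φ)
    (e : V) : ∃ C, ∀ x, |fderiv ℝ φ x e| ≤ C := by
  have h1 : ContDiff ℝ 1 φ := hφ.of_le (by exact_mod_cast le_top)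
  obtain ⟨C, hC⟩ := (h1.continuous_fderiv one_ne_zero).bounded_above_of_compact_support
    (hc.fderiv ℝ)
  exact ⟨C * ‖e‖, fun x => ((fderiv ℝ φ x).le_opNorm e).trans
    (mul_le_mul_of_nonneg_right (hC x) (norm_nonneg e))⟩

/-- Chain rule for weak gradients. -/
theorem IsWeakGradient.integral_comp {u : V → ℝ} {G : V → V} (h : IsWeakGradient u G)
    {β : ℝ → ℝ} (hβ : ContDiff ℝ 1 β) {M : ℝ} (hM : ∀ s, |deriv β s| ≤ M)
    {φ : V → ℝ} (hφ : ContDiff ℝ (⊤ : ℕ∞) φ) (hc : HasCompactSupport φ) (e : V) :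
    ∫ v, β (u v) * fderiv ℝ φ v e = -∫ v, deriv β (u v) * inner ℝ (G v) e * φ v := by
  set D : V → ℝ := fun v => inner ℝ (G v) e with hD
  have hDl : LocallyIntegrable D := by
    intro x
    obtain ⟨s, hs, hi⟩ := h.locInt_grad x
    exact ⟨s, hs, hi.inner_const e⟩
  have hφ1 : ContDiff ℝ 1 φ := hφ.of_le (by exact_mod_cast le_top)
  obtain ⟨B, hB⟩ := hφ.continuous.bounded_above_of_compact_support hc
  obtain ⟨B', hB'⟩ := abs_fderiv_apply_le hφ hc e
  have hfc : Continuous fun x => fderiv ℝ φ x e :=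
    (hφ1.continuous_fderiv one_ne_zero).clm_apply continuous_const
  have hfs : HasCompactSupport fun x => fderiv ℝ φ x e := hc.fderiv_apply ℝ e
  have hdc : Continuous (deriv β) := hβ.continuous_deriv le_rfl
  have hLip : ∀ s t, |β s - β t| ≤ M * |s - t| := by
    intro s t
    have := Convex.norm_image_sub_le_of_norm_deriv_le (f := β) (s := Set.univ) (x := t) (y := s)
      (C := M) (fun x _ => (hβ.differentiable one_ne_zero) x) (fun x _ => hM x) convex_univ
      (Set.mem_univ _) (Set.mem_univ _)
    simpa using this
  have hmc : ∀ n, ContDiff ℝ 1 (mol n u) := fun n => mol_contDiff n h.locInt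
  have hbm : ∀ n, ContDiff ℝ 1 fun x => β (mol n u x) := fun n => hβ.comp (hmc n)
  have hfd : ∀ n x, fderiv ℝ (fun x => β (mol n u x)) x e = deriv β (mol n u x) * mol n D x := by
    intro n x
    have := ((hβ.differentiable one_ne_zero) (mol n u x)).hasDerivAt.comp_hasFDerivAt x
      ((hmc n).differentiable one_ne_zero x).hasFDerivAt
    have h2 : fderiv ℝ (fun x => β (mol n u x)) x = _ := this.fderiv
    rw [h2]
    simp [fderiv_mol n h x e, hD]
  have hfdc : ∀ n, Continuous fun x => fderiv ℝ (fun x => β (mol n u x)) x e := fun n =>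
    ((hbm n).continuous_fderiv one_ne_zero).clm_apply continuous_const
  -- Classical integration by parts for the mollified function. The right side converges because
  -- `deriv β` is bounded and continuous while the gradient converges in `L¹_loc`; the left side
  -- because `β` is Lipschitz.
  have hn : ∀ n, ∫ v, β (mol n u v) * fderiv ℝ φ v e =
      -∫ v, (deriv β (mol n u v) * φ v) * mol n D v := by
    intro n
    rw [integral_mul_fderiv_eq_neg_fderiv_mul_of_integrable]
    · congr 2; funext v; rw [hfd]; ring
    · exact (((hfdc n).mul hφ.continuous).integrable_of_hasCompactSupport hc.mul_left)
    · exact (((hbm n).continuous.mul hfc).integrable_of_hasCompactSupport hfs.mul_left)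
    · exact (((hbm n).continuous.mul hφ.continuous).integrable_of_hasCompactSupport hc.mul_left)
    · exact fun x _ => (hbm n).differentiable one_ne_zero x
    · exact fun x _ => hφ1.differentiable one_ne_zero x
  have hrhs : Tendsto (fun n => -∫ v, (deriv β (mol n u v) * φ v) * mol n D v) atTop
      (𝓝 (-∫ v, (deriv β (u v) * φ v) * D v)) := by
    refine (tendsto_integral_mul_mol hDl (K := tsupport φ) hc (C := M * B) ?_ ?_ ?_ ?_).neg
    · exact fun n => ((hdc.comp (hmc n).continuous).mul hφ.continuous).aestronglyMeasurable
    · intro n x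
      rw [abs_mul]
      exact mul_le_mul (hM _) (hB x) (abs_nonneg _) ((abs_nonneg _).trans (hM 0))
    · intro n x hx
      rw [image_eq_zero_of_notMem_tsupport hx, mul_zero]
    · filter_upwards [mol_tendsto_ae h.locInt] with x hx
      exact ((hdc.tendsto _).comp hx).mul_const _
  have hbl : LocallyIntegrable fun v => β (u v) := by
    have h0 : LocallyIntegrable fun v => |u v| := fun x => by
      obtain ⟨s, hs, hi⟩ := h.locInt x
      exact ⟨s, hs, hi.abs⟩
    have h1 : LocallyIntegrable fun v => |β 0| + M * |u v| :=
      (locallyIntegrable_const _).add (h0.smul M)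
    refine h1.mono (hβ.continuous.comp_aestronglyMeasurable h.locInt.aestronglyMeasurable)
      (Eventually.of_forall fun v => ?_)
    have := hLip (u v) 0
    rw [sub_zero] at this
    have h3 : |β (u v)| ≤ |β 0| + |β (u v) - β 0| := by
      have := abs_add_le (β 0) (β (u v) - β 0)
      simpa using this
    simp only [Real.norm_eq_abs]
    exact (h3.trans (by linarith)).trans (le_abs_self _)
  have hlhs : Tendsto (fun n => ∫ v, β (mol n u v) * fderiv ℝ φ v e) atTop
      (𝓝 (∫ v, β (u v) * fderiv ℝ φ v e)) := by
    have hK : IsCompact (tsupport fun x => fderiv ℝ φ x e) := hfs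
    have h3 := (mol_tendsto_L1_on h.locInt hK).const_mul (B' * M)
    rw [mul_zero] at h3
    rw [tendsto_iff_norm_sub_tendsto_zero]
    refine squeeze_zero (fun n => norm_nonneg _) (fun n => ?_) h3
    rw [← integral_sub, ← integral_const_mul, ← integral_indicator hK.measurableSet]
    · refine norm_integral_le_of_norm_le ?_ (Eventually.of_forall fun x => ?_)
      · rw [integrable_indicator_iff hK.measurableSet]
        exact (((((hmc n).continuous.locallyIntegrable).sub
          h.locInt).integrableOn_isCompact hK).abs).const_mul _
      · by_cases hx : x ∈ tsupport fun x => fderiv ℝ φ x e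
        · simp only [hx, Set.indicator_of_mem]
          rw [← sub_mul, norm_mul, Real.norm_eq_abs, Real.norm_eq_abs, mul_comm, mul_assoc]
          exact mul_le_mul (hB' x) (hLip _ _) (abs_nonneg _) ((abs_nonneg _).trans (hB' 0))
        · have := image_eq_zero_of_notMem_tsupport hx
          simp [this, hx]
    · exact (((hbm n).continuous.mul hfc).integrable_of_hasCompactSupport hfs.mul_left)
    · exact hbl.integrable_smul_right_of_hasCompactSupport hfc hfs
  have hfin := tendsto_nhds_unique hlhs (hrhs.congr fun n => (hn n).symm)
  rw [hfin]
  congr 2; funext v; simp only [hD]; ring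

theorem locallyIntegrable_inner {G : V → V} (hG : LocallyIntegrable G) (e : V) :
    LocallyIntegrable fun v => inner ℝ (G v) e := by
  intro x
  obtain ⟨s, hs, hi⟩ := hG x
  exact ⟨s, hs, hi.inner_const e⟩

theorem integrable_inner_mul {G : V → V} (hG : LocallyIntegrable G) (e : V) {φ : V → ℝ}
    (hφ : Continuous φ) (hc : HasCompactSupport φ) :
    Integrable fun v => inner ℝ (G v) e * φ v :=
  (locallyIntegrable_inner hG e).integrable_smul_right_of_hasCompactSupport hφ hc

/-- The weak gradient vanishes almost everywhere on level sets. -/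
theorem IsWeakGradient.ae_eq_zero_of_level {u : V → ℝ} {G : V → V} (h : IsWeakGradient u G)
    (c : ℝ) : ∀ᵐ v, u v = c → G v = 0 := by
  have hum := h.locInt.aestronglyMeasurable
  have hdir : ∀ e : V, ∀ᵐ v, (if u v = c then (1 : ℝ) else 0) * inner ℝ (G v) e = 0 := by
    intro e
    set I : V → ℝ := fun v => if u v = c then (1 : ℝ) else 0 with hI
    have hIm : AEStronglyMeasurable I volume := by
      have : Measurable fun s : ℝ => if s = c then (1 : ℝ) else 0 :=
        Measurable.ite (measurableSet_singleton c) measurable_const measurable_const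
      exact (this.comp_aemeasurable hum.aemeasurable).aestronglyMeasurable
    have hI1 : ∀ v, |I v| ≤ 1 := fun v => by simp only [hI]; split_ifs <;> simp
    refine ae_eq_zero_of_integral_contDiff_smul_eq_zero ?_ ?_
    · refine (locallyIntegrable_inner h.locInt_grad e).mono
        (hIm.mul (locallyIntegrable_inner h.locInt_grad e).aestronglyMeasurable)
        (Eventually.of_forall fun v => ?_)
      rw [norm_mul]
      exact mul_le_of_le_one_left (norm_nonneg _) (hI1 v)
    · intro φ hφ hc
      set δ : ℕ → ℝ := fun n => 1 / ((n : ℝ) + 1) with hδ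
      have hδ0 : ∀ n, 0 < δ n := fun n => by simp only [hδ]; positivity
      have hδlim : Tendsto δ atTop (𝓝 0) := tendsto_one_div_add_atTop_nhds_zero_nat
      -- These functions tend to `0` uniformly, while their derivatives stay in `[0, 1]` and tend to
      -- the indicator of `{c}`. In the limit the chain rule says that the gradient restricted to `u
      -- = c` is the zero distribution.
      set β : ℕ → ℝ → ℝ := fun n s => δ n * Real.arctan ((s - c) / δ n) with hβ
      have hβd : ∀ n, deriv (β n) = fun s => 1 / (1 + ((s - c) / δ n) ^ 2) := by
        intro n; funext s
        have h1 : HasDerivAt (fun s => (s - c) / δ n) (1 / δ n) s :=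
          ((hasDerivAt_id s).sub_const c).div_const _
        have h2 := (h1.arctan).const_mul (δ n)
        have h3 : deriv (β n) s = _ := h2.deriv
        rw [h3]
        have := (hδ0 n).ne'
        field_simp
      have hβc : ∀ n, ContDiff ℝ 1 (β n) := fun n => contDiff_const.mul
        (Real.contDiff_arctan.comp ((contDiff_id.sub contDiff_const).div_const _))
      have hβ1 : ∀ n s, |deriv (β n) s| ≤ 1 := by
        intro n s
        rw [hβd, abs_of_nonneg (by positivity), div_le_one (by positivity)]
        nlinarith [sq_nonneg ((s - c) / δ n)]
      have hchain := fun n => h.integral_comp (hβc n) (hβ1 n) hφ hc e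
      have hl : Tendsto (fun n => ∫ v, β n (u v) * fderiv ℝ φ v e) atTop (𝓝 0) := by
        have hφ1 : ContDiff ℝ 1 φ := hφ.of_le (by exact_mod_cast le_top)
        have hfc : Continuous fun x => fderiv ℝ φ x e :=
          (hφ1.continuous_fderiv one_ne_zero).clm_apply continuous_const
        have hfs : HasCompactSupport fun x => fderiv ℝ φ x e := hc.fderiv_apply ℝ e
        have hfi := (hfc.integrable_of_hasCompactSupport hfs (μ := volume)).norm
        rw [tendsto_zero_iff_norm_tendsto_zero]
        have h3 : Tendsto (fun n => δ n * (2 * ∫ v, ‖fderiv ℝ φ v e‖)) atTop (𝓝 0) := by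
          simpa using hδlim.mul_const (2 * ∫ v, ‖fderiv ℝ φ v e‖)
        refine squeeze_zero (fun n => norm_nonneg _) (fun n => ?_) h3
        rw [← mul_assoc, ← integral_const_mul]
        refine norm_integral_le_of_norm_le (hfi.const_mul _) (Eventually.of_forall fun v => ?_)
        rw [norm_mul]
        refine mul_le_mul_of_nonneg_right ?_ (norm_nonneg _)
        simp only [hβ]
        rw [norm_mul, Real.norm_of_nonneg (hδ0 n).le]
        refine mul_le_mul_of_nonneg_left ?_ (hδ0 n).le
        rw [Real.norm_eq_abs, abs_le]
        constructor
        · linarith [Real.neg_pi_div_two_lt_arctan ((u v - c) / δ n), Real.pi_lt_four]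
        · linarith [Real.arctan_lt_pi_div_two ((u v - c) / δ n), Real.pi_lt_four]
      have hGi := integrable_inner_mul h.locInt_grad e hφ.continuous hc
      have hr : Tendsto (fun n => ∫ v, deriv (β n) (u v) * inner ℝ (G v) e * φ v) atTop
          (𝓝 (∫ v, I v * inner ℝ (G v) e * φ v)) := by
        refine tendsto_integral_of_dominated_convergence _ ?_ hGi.norm ?_ ?_
        · intro n
          simp_rw [mul_assoc]
          exact (((hβc n).continuous_deriv le_rfl).comp_aestronglyMeasurable hum).mul
            hGi.aestronglyMeasurable
        · refine fun n => Eventually.of_forall fun v => ?_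
          rw [mul_assoc, norm_mul]
          exact mul_le_of_le_one_left (norm_nonneg _) (hβ1 n _)
        · refine Eventually.of_forall fun v => ?_
          refine Tendsto.mul_const _ (Tendsto.mul_const _ ?_)
          simp only [hβd, hI]
          split_ifs with hv
          · simp [hv]
          · have hne : 0 < |u v - c| := abs_pos.2 (sub_ne_zero.2 hv)
            have h1 : Tendsto (fun n => (δ n) ^ 2 / ((δ n) ^ 2 + (u v - c) ^ 2)) atTop
                (𝓝 (0 ^ 2 / (0 ^ 2 + (u v - c) ^ 2))) := by
              refine (hδlim.pow 2).div ((hδlim.pow 2).add_const _) ?_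
              have := sq_pos_of_pos hne
              rw [sq_abs] at this
              positivity
            rw [zero_pow two_ne_zero, zero_div] at h1
            refine h1.congr fun n => ?_
            have := (hδ0 n).ne'
            field_simp
      have h0 : ∫ v, I v * inner ℝ (G v) e * φ v = 0 := by
        have h1 := tendsto_nhds_unique (hl.congr hchain) hr.neg
        linarith
      refine Eq.trans ?_ h0
      congr 1; funext v; simp only [smul_eq_mul, hI]; ring
  have hall : ∀ᵐ v, ∀ i : Fin 3,
      (if u v = c then (1 : ℝ) else 0) * inner ℝ (G v) (EuclideanSpace.single i (1 : ℝ)) = 0 :=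
    ae_all_iff.2 fun i => hdir _
  filter_upwards [hall] with v hv huv
  ext i
  have := hv i
  simpa [huv, EuclideanSpace.inner_single_right] using this

/-- The weak gradient of `√u` in terms of a weak gradient `G` of `u`. -/
def sqrtGrad (u : V → ℝ) (G : V → V) (v : V) : V := (2 * Real.sqrt (u v))⁻¹ • G v

/-- A smooth regularization of the square root. -/
def regSqrt (δ s : ℝ) : ℝ := Real.sqrt (Real.sqrt (s ^ 2 + δ ^ 2))

theorem hasDerivAt_regSqrt {δ : ℝ} (hδ : 0 < δ) (s : ℝ) :
    HasDerivAt (regSqrt δ)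
      (s / Real.sqrt (s ^ 2 + δ ^ 2) / (2 * Real.sqrt (Real.sqrt (s ^ 2 + δ ^ 2)))) s := by
  have h0 : 0 < s ^ 2 + δ ^ 2 := by positivity
  have h1 : HasDerivAt (fun s : ℝ => s ^ 2 + δ ^ 2) (2 * s) s := by
    simpa using (hasDerivAt_pow 2 s).add_const (δ ^ 2)
  have h2 := (h1.sqrt h0.ne').sqrt (Real.sqrt_pos.2 h0).ne'
  have e : 2 * s / (2 * Real.sqrt (s ^ 2 + δ ^ 2)) = s / Real.sqrt (s ^ 2 + δ ^ 2) :=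
    mul_div_mul_left _ _ two_ne_zero
  rw [e] at h2
  exact h2

theorem contDiff_regSqrt {δ : ℝ} (hδ : 0 < δ) : ContDiff ℝ 1 (regSqrt δ) := by
  have h0 : ∀ s : ℝ, 0 < s ^ 2 + δ ^ 2 := fun s => by positivity
  exact (((contDiff_id.pow 2).add contDiff_const).sqrt fun s => (h0 s).ne').sqrt
    fun s => (Real.sqrt_pos.2 (h0 s)).ne'

theorem abs_le_sqrt_sq_add {δ : ℝ} (s : ℝ) : |s| ≤ Real.sqrt (s ^ 2 + δ ^ 2) :=
  Real.abs_le_sqrt (by nlinarith [sq_nonneg δ])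

theorem abs_div_sqrt_le_one {δ : ℝ} (s : ℝ) : |s / Real.sqrt (s ^ 2 + δ ^ 2)| ≤ 1 := by
  rw [abs_div, abs_of_nonneg (Real.sqrt_nonneg _)]
  exact div_le_one_of_le₀ (abs_le_sqrt_sq_add s) (Real.sqrt_nonneg _)

theorem abs_deriv_regSqrt_le {δ : ℝ} (hδ : 0 < δ) (s : ℝ) :
    |deriv (regSqrt δ) s| ≤ (2 * Real.sqrt δ)⁻¹ := by
  rw [(hasDerivAt_regSqrt hδ s).deriv, abs_div, div_eq_mul_inv]
  have h1 : δ ≤ Real.sqrt (s ^ 2 + δ ^ 2) := Real.le_sqrt_of_sq_le (by nlinarith [sq_nonneg s])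
  have h2 := Real.sqrt_le_sqrt h1
  have h3 := Real.sqrt_pos.2 hδ
  calc _ ≤ 1 * |2 * Real.sqrt (Real.sqrt (s ^ 2 + δ ^ 2))|⁻¹ :=
        mul_le_mul_of_nonneg_right (abs_div_sqrt_le_one s) (by positivity)
    _ ≤ _ := by
        rw [one_mul, abs_of_nonneg (by positivity)]
        gcongr

/-- This bound is uniform in `δ` and makes `sqrtGrad` the dominating function when `δ → 0`; the
preceding bound, which degenerates, only makes the chain rule applicable. At `s = 0` both sides
vanish, since `0⁻¹ = 0`. -/
theorem abs_deriv_regSqrt_le_inv_sqrt {δ : ℝ} (hδ : 0 < δ) {s : ℝ} (hs : 0 ≤ s) :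
    |deriv (regSqrt δ) s| ≤ (2 * Real.sqrt s)⁻¹ := by
  rw [(hasDerivAt_regSqrt hδ s).deriv]
  rcases hs.eq_or_lt with rfl | hs
  · simp
  rw [abs_div, div_eq_mul_inv]
  have h1 : s ≤ Real.sqrt (s ^ 2 + δ ^ 2) := Real.le_sqrt_of_sq_le (by nlinarith [sq_nonneg δ])
  have h2 := Real.sqrt_le_sqrt h1
  have h3 := Real.sqrt_pos.2 hs
  calc _ ≤ 1 * |2 * Real.sqrt (Real.sqrt (s ^ 2 + δ ^ 2))|⁻¹ :=
        mul_le_mul_of_nonneg_right (abs_div_sqrt_le_one s) (by positivity)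
    _ ≤ _ := by
        rw [one_mul, abs_of_nonneg (by positivity)]
        gcongr

theorem tendsto_regSqrt {δ : ℕ → ℝ} (hlim : Tendsto δ atTop (𝓝 0)) {s : ℝ} (hs : 0 ≤ s) :
    Tendsto (fun n => regSqrt (δ n) s) atTop (𝓝 (Real.sqrt s)) := by
  have hc : Continuous fun d : ℝ => regSqrt d s := by unfold regSqrt; fun_prop
  have e : regSqrt 0 s = Real.sqrt s := by simp [regSqrt, Real.sqrt_sq hs]
  rw [← e]
  exact (hc.tendsto 0).comp hlim

theorem tendsto_deriv_regSqrt {δ : ℕ → ℝ} (hδ : ∀ n, 0 < δ n) (hlim : Tendsto δ atTop (𝓝 0))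
    {s : ℝ} (hs : 0 ≤ s) :
    Tendsto (fun n => deriv (regSqrt (δ n)) s) atTop (𝓝 (2 * Real.sqrt s)⁻¹) := by
  simp_rw [fun n => (hasDerivAt_regSqrt (hδ n) s).deriv]
  rcases hs.eq_or_lt with rfl | hs
  · simp
  have hc : Tendsto (fun n => Real.sqrt (s ^ 2 + δ n ^ 2)) atTop (𝓝 (Real.sqrt (s ^ 2 + 0 ^ 2))) :=
    ((hlim.pow 2).const_add _).sqrt
  have e : Real.sqrt (s ^ 2 + 0 ^ 2) = s := by simp [Real.sqrt_sq hs.le]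
  rw [e] at hc
  have h3 := Real.sqrt_pos.2 hs
  have := ((tendsto_const_nhds (x := s)).div hc hs.ne').div (hc.sqrt.const_mul 2)
    (by positivity)
  rw [div_self hs.ne', one_div] at this
  exact this

/-- The weak gradient of the square root of a nonnegative function. -/
theorem IsWeakGradient.sqrt {u : V → ℝ} {G : V → V} (h : IsWeakGradient u G)
    (h0 : ∀ᵐ v, 0 ≤ u v) (hi : LocallyIntegrable (sqrtGrad u G)) :
    IsWeakGradient (fun v => Real.sqrt (u v)) (sqrtGrad u G) := by
  have hum := h.locInt.aestronglyMeasurable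
  have habs : LocallyIntegrable fun v => 2 + |u v| := by
    refine (locallyIntegrable_const _).add fun x => ?_
    obtain ⟨s, hs, hi⟩ := h.locInt x
    exact ⟨s, hs, hi.abs⟩
  have hsm : AEStronglyMeasurable (fun v => Real.sqrt (u v)) volume :=
    Real.continuous_sqrt.comp_aestronglyMeasurable hum
  have hroot : ∀ s : ℝ, 0 ≤ s → Real.sqrt s ≤ 1 + s := fun s hs => by
    rw [Real.sqrt_le_left (by linarith)]; nlinarith
  refine ⟨habs.mono hsm (Eventually.of_forall fun v => ?_), hi, fun φ hφ hc e => ?_⟩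
  · rw [Real.norm_of_nonneg (Real.sqrt_nonneg _)]
    refine le_trans ?_ (le_abs_self _)
    refine (Real.sqrt_le_sqrt (le_abs_self _)).trans ?_
    linarith [hroot |u v| (abs_nonneg _)]
  set δ : ℕ → ℝ := fun n => 1 / ((n : ℝ) + 1) with hδ
  have hδ0 : ∀ n, 0 < δ n := fun n => by simp only [hδ]; positivity
  have hδ1 : ∀ n, δ n ≤ 1 := fun n => by
    simp only [hδ]; rw [div_le_one (by positivity)]
    have : (0 : ℝ) ≤ n := n.cast_nonneg
    linarith
  have hδlim : Tendsto δ atTop (𝓝 0) := tendsto_one_div_add_atTop_nhds_zero_nat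
  have hφ1 : ContDiff ℝ 1 φ := hφ.of_le (by exact_mod_cast le_top)
  have hfc : Continuous fun x => fderiv ℝ φ x e :=
    (hφ1.continuous_fderiv one_ne_zero).clm_apply continuous_const
  have hfs : HasCompactSupport fun x => fderiv ℝ φ x e := hc.fderiv_apply ℝ e
  have hchain := fun n => h.integral_comp (contDiff_regSqrt (hδ0 n))
    (abs_deriv_regSqrt_le (hδ0 n)) hφ hc e
  have hl : Tendsto (fun n => ∫ v, regSqrt (δ n) (u v) * fderiv ℝ φ v e) atTop
      (𝓝 (∫ v, Real.sqrt (u v) * fderiv ℝ φ v e)) := by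
    have hb := (habs.integrable_smul_right_of_hasCompactSupport hfc hfs).norm
    refine tendsto_integral_of_dominated_convergence _ (fun n => ?_) hb (fun n => ?_) ?_
    · exact ((contDiff_regSqrt (hδ0 n)).continuous.comp_aestronglyMeasurable hum).mul
        hfc.aestronglyMeasurable
    · refine Eventually.of_forall fun v => ?_
      rw [smul_eq_mul, norm_mul, norm_mul]
      refine mul_le_mul_of_nonneg_right ?_ (norm_nonneg _)
      rw [regSqrt, Real.norm_of_nonneg (Real.sqrt_nonneg _), Real.norm_of_nonneg (by positivity)]
      have h1 : Real.sqrt (u v ^ 2 + δ n ^ 2) ≤ |u v| + 1 := by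
        rw [Real.sqrt_le_left (by positivity)]
        have h3 : δ n ^ 2 ≤ 1 := pow_le_one₀ (hδ0 n).le (hδ1 n)
        rw [← sq_abs (u v)]
        nlinarith [abs_nonneg (u v)]
      linarith [Real.sqrt_le_sqrt h1, hroot (|u v| + 1) (by positivity),
        hroot _ (Real.sqrt_nonneg (u v ^ 2 + δ n ^ 2))]
    · filter_upwards [h0] with v hv
      exact (tendsto_regSqrt hδlim hv).mul_const _
  have hr : Tendsto (fun n => ∫ v, deriv (regSqrt (δ n)) (u v) * inner ℝ (G v) e * φ v) atTop
      (𝓝 (∫ v, inner ℝ (sqrtGrad u G v) e * φ v)) := by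
    have hb := (integrable_inner_mul hi e hφ.continuous hc).norm
    have hGi := integrable_inner_mul h.locInt_grad e hφ.continuous hc
    refine tendsto_integral_of_dominated_convergence _ (fun n => ?_) hb (fun n => ?_) ?_
    · simp_rw [mul_assoc]
      exact (((contDiff_regSqrt (hδ0 n)).continuous_deriv le_rfl).comp_aestronglyMeasurable
        hum).mul hGi.aestronglyMeasurable
    · filter_upwards [h0] with v hv
      simp only [sqrtGrad, real_inner_smul_left, norm_mul]
      gcongr
      exact (abs_deriv_regSqrt_le_inv_sqrt (hδ0 n) hv).trans (le_abs_self _)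
    · filter_upwards [h0] with v hv
      simp only [sqrtGrad, real_inner_smul_left]
      exact ((tendsto_deriv_regSqrt hδ0 hδlim hv).mul_const _).mul_const _
  exact tendsto_nhds_unique hl ((hr.neg).congr fun n => (hchain n).symm)

/-! ### The entropy density is controlled by `F^(3/4)` -/

theorem neg_mul_log_le_rpow {t : ℝ} (ht : 0 ≤ t) : -(t * Real.log t) ≤ 4 * t ^ (3 / 4 : ℝ) := by
  rcases ht.eq_or_lt with rfl | ht
  · simp
  set τ := t ^ (1 / 4 : ℝ) with hτ
  have hτ0 : 0 < τ := Real.rpow_pos_of_pos ht _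
  have h4 : t = τ ^ 4 := by
    rw [hτ, ← Real.rpow_natCast, ← Real.rpow_mul ht.le]; norm_num
  have h3 : t ^ (3 / 4 : ℝ) = τ ^ 3 := by
    rw [hτ, ← Real.rpow_natCast, ← Real.rpow_mul ht.le]; norm_num
  have hl : Real.log t = 4 * Real.log τ := by
    rw [h4, Real.log_pow]; norm_num
  have h1 := Real.one_sub_inv_le_log_of_pos hτ0
  rw [h3, hl, h4]
  have h2 : τ ^ 4 * (1 - τ⁻¹) ≤ τ ^ 4 * Real.log τ := by gcongr
  have h5 : τ ^ 4 * (1 - τ⁻¹) = τ ^ 4 - τ ^ 3 := by field_simp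
  have : 0 ≤ τ ^ 4 := by positivity
  linarith

theorem neg_one_sub_mul_log_le {t : ℝ} (ht : t ≤ 1) :
    -((1 - t) * Real.log (1 - t)) ≤ t := by
  rcases ht.eq_or_lt with rfl | ht
  · simp
  have h0 : 0 < 1 - t := by linarith
  have h1 := Real.one_sub_inv_le_log_of_pos h0
  have h2 : (1 - t) * (1 - (1 - t)⁻¹) ≤ (1 - t) * Real.log (1 - t) := by gcongr
  have h3 : (1 - t) * (1 - (1 - t)⁻¹) = -t := by field_simp; ring
  linarith

theorem binary_entropy_le_rpow_of_le_half {t : ℝ} (h0 : 0 ≤ t) (h1 : t ≤ 1 / 2) :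
    -(t * Real.log t + (1 - t) * Real.log (1 - t)) ≤ 10 * (t * (1 - t)) ^ (3 / 4 : ℝ) := by
  have ha := neg_mul_log_le_rpow h0
  have hb := neg_one_sub_mul_log_le (t := t) (by linarith)
  have hc : t ≤ t ^ (3 / 4 : ℝ) := by
    have := Real.rpow_le_rpow_of_exponent_ge' h0 (by linarith) (by norm_num)
      (show (3 / 4 : ℝ) ≤ 1 by norm_num)
    simpa using this
  have hd : t ^ (3 / 4 : ℝ) ≤ 2 * (t * (1 - t)) ^ (3 / 4 : ℝ) := by
    calc t ^ (3 / 4 : ℝ) ≤ (2 * (t * (1 - t))) ^ (3 / 4 : ℝ) :=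
          Real.rpow_le_rpow h0 (by nlinarith) (by norm_num)
      _ = 2 ^ (3 / 4 : ℝ) * (t * (1 - t)) ^ (3 / 4 : ℝ) :=
          Real.mul_rpow (by norm_num) (mul_nonneg h0 (by linarith))
      _ ≤ _ := by
          gcongr
          · exact Real.rpow_nonneg (mul_nonneg h0 (by linarith)) _
          · have := Real.rpow_le_rpow_of_exponent_le (show (1 : ℝ) ≤ 2 by norm_num)
              (show (3 / 4 : ℝ) ≤ 1 by norm_num)
            simpa using this
  linarith

/-- Both sides are symmetric under `t ↦ 1 - t`. For `t ≤ 1/2` the left side is at most `5 t^(3/4)`,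
and `t ≤ 2 t (1 - t)`. An exponent below `1` absorbs the logarithm; `3/4` leaves the weight `B⁻³` in
the later Young inequality. -/
theorem binary_entropy_le_rpow {t : ℝ} (h0 : 0 ≤ t) (h1 : t ≤ 1) :
    -(t * Real.log t + (1 - t) * Real.log (1 - t)) ≤ 10 * (t * (1 - t)) ^ (3 / 4 : ℝ) := by
  rcases le_total t (1 / 2) with h | h
  · exact binary_entropy_le_rpow_of_le_half h0 h
  · have := binary_entropy_le_rpow_of_le_half (t := 1 - t) (by linarith) (by linarith)
    have e : 1 - (1 - t) = t := by ring
    rw [e] at this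
    rw [mul_comm t (1 - t)]
    linarith

/-- The density of the Fermi-Dirac entropy. -/
def entropyDensity (ε x : ℝ) : ℝ :=
  -ε⁻¹ * (ε * x * Real.log (ε * x) + (1 - ε * x) * Real.log (1 - ε * x))

/-- The binary entropy bound alone gives the constant `10 ε^(-1/4)`, good only for `ε` comparable to
`ε₀`. For small `ε`, subtracting `log (ε₀ / ε) x` replaces `log (ε x)` by `log (ε₀ x)`, leaving at
most `-x log (ε₀ x) + x`. This is nonpositive for `ε₀ x ≥ 4`; for `ε₀ x ≤ 4` one has `ε x ≤ 1/2`, so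
`F ≥ x / 2`. -/
theorem entropyDensity_le {ε ε₀ x : ℝ} (hε : 0 < ε) (hε₀ : ε ≤ ε₀) (hx : 0 ≤ x)
    (hx1 : ε * x ≤ 1) :
    entropyDensity ε x - Real.log (ε₀ / ε) * x ≤
      20 * ε₀ ^ (-(1 / 4) : ℝ) * (x * (1 - ε * x)) ^ (3 / 4 : ℝ) := by
  have h0 : 0 < ε₀ := hε.trans_le hε₀
  have hF : 0 ≤ x * (1 - ε * x) := mul_nonneg hx (by linarith)
  have hl : 0 ≤ Real.log (ε₀ / ε) := Real.log_nonneg (by rwa [one_le_div hε])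
  have hpow : ∀ a : ℝ, 0 < a → a⁻¹ * a ^ (3 / 4 : ℝ) = a ^ (-(1 / 4) : ℝ) := by
    intro a ha
    rw [← Real.rpow_neg_one, ← Real.rpow_add ha]; norm_num
  rcases le_total (ε₀ / 8) ε with h | h
  · have h1 := binary_entropy_le_rpow (mul_nonneg hε.le hx) hx1
    have h2 : entropyDensity ε x ≤ ε⁻¹ * (10 * (ε * x * (1 - ε * x)) ^ (3 / 4 : ℝ)) := by
      unfold entropyDensity
      rw [neg_mul, ← mul_neg]
      gcongr
    have h3 : ε⁻¹ * (10 * (ε * x * (1 - ε * x)) ^ (3 / 4 : ℝ)) =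
        10 * ε ^ (-(1 / 4) : ℝ) * (x * (1 - ε * x)) ^ (3 / 4 : ℝ) := by
      rw [mul_assoc ε, Real.mul_rpow hε.le hF, ← hpow ε hε]; ring
    have h4 : ε ^ (-(1 / 4) : ℝ) ≤ 2 * ε₀ ^ (-(1 / 4) : ℝ) := by
      calc ε ^ (-(1 / 4) : ℝ) ≤ (ε₀ / 8) ^ (-(1 / 4) : ℝ) :=
            Real.rpow_le_rpow_of_nonpos (by positivity) h (by norm_num)
        _ = 8 ^ (1 / 4 : ℝ) * ε₀ ^ (-(1 / 4) : ℝ) := by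
            rw [Real.div_rpow h0.le (by norm_num), Real.rpow_neg (by norm_num : (0 : ℝ) ≤ 8)]
            field_simp
        _ ≤ _ := by
            gcongr
            calc (8 : ℝ) ^ (1 / 4 : ℝ) ≤ 16 ^ (1 / 4 : ℝ) :=
                  Real.rpow_le_rpow (by norm_num) (by norm_num) (by norm_num)
              _ = 2 := by
                  rw [show (16 : ℝ) = 2 ^ (4 : ℝ) by norm_num, ← Real.rpow_mul (by norm_num)]
                  norm_num
    have h5 : 10 * ε ^ (-(1 / 4) : ℝ) * (x * (1 - ε * x)) ^ (3 / 4 : ℝ) ≤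
        10 * (2 * ε₀ ^ (-(1 / 4) : ℝ)) * (x * (1 - ε * x)) ^ (3 / 4 : ℝ) := by gcongr
    have h6 : 0 ≤ Real.log (ε₀ / ε) * x := mul_nonneg hl hx
    linarith
  · have hR : 0 ≤ 20 * ε₀ ^ (-(1 / 4) : ℝ) * (x * (1 - ε * x)) ^ (3 / 4 : ℝ) := by positivity
    rcases hx.eq_or_lt with rfl | hxp
    · simp [entropyDensity]
    have h1 := neg_one_sub_mul_log_le hx1
    have h2 : entropyDensity ε x - Real.log (ε₀ / ε) * x ≤ -(x * Real.log (ε₀ * x)) + x := by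
      have e1 : entropyDensity ε x = -(x * Real.log (ε * x)) +
          ε⁻¹ * -((1 - ε * x) * Real.log (1 - ε * x)) := by
        unfold entropyDensity; field_simp; ring
      have e2 : ε⁻¹ * -((1 - ε * x) * Real.log (1 - ε * x)) ≤ ε⁻¹ * (ε * x) := by gcongr
      rw [inv_mul_cancel_left₀ hε.ne'] at e2
      have e3 : Real.log (ε₀ * x) = Real.log (ε₀ / ε) + Real.log (ε * x) := by
        rw [← Real.log_mul (by positivity) (by positivity)]
        congr 1; field_simp
      rw [e1, e3]
      linarith
    refine h2.trans ?_
    rcases le_total 4 (ε₀ * x) with h4 | h4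
    · have : 1 ≤ Real.log (ε₀ * x) := by
        rw [Real.le_log_iff_exp_le (by positivity)]
        linarith [Real.exp_one_lt_d9]
      nlinarith
    · set y := ε₀ * x with hy
      have hy0 : 0 < y := by positivity
      have h5 := neg_mul_log_le_rpow hy0.le
      have h6 : y ≤ 2 * y ^ (3 / 4 : ℝ) := by
        have e : y = y ^ (1 / 4 : ℝ) * y ^ (3 / 4 : ℝ) := by
          rw [← Real.rpow_add hy0]; norm_num
        calc y = y ^ (1 / 4 : ℝ) * y ^ (3 / 4 : ℝ) := e
          _ ≤ 16 ^ (1 / 4 : ℝ) * y ^ (3 / 4 : ℝ) := by gcongr; linarith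
          _ = _ := by
            rw [show (16 : ℝ) = 2 ^ (4 : ℝ) by norm_num, ← Real.rpow_mul (by norm_num)]
            norm_num
      have h7 : -(x * Real.log y) + x = ε₀⁻¹ * (-(y * Real.log y) + y) := by
        rw [hy]; field_simp
      have h8 : -(x * Real.log y) + x ≤ ε₀⁻¹ * (6 * y ^ (3 / 4 : ℝ)) := by
        rw [h7]; gcongr; linarith
      have h9 : ε₀⁻¹ * (6 * y ^ (3 / 4 : ℝ)) = 6 * ε₀ ^ (-(1 / 4) : ℝ) * x ^ (3 / 4 : ℝ) := by
        rw [hy, Real.mul_rpow h0.le hx, ← hpow ε₀ h0]; ring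
      have h10 : x ^ (3 / 4 : ℝ) ≤ 2 * (x * (1 - ε * x)) ^ (3 / 4 : ℝ) := by
        have hh : ε * x ≤ 1 / 2 := by
          have : ε * x ≤ ε₀ / 8 * x := by gcongr
          linarith
        calc x ^ (3 / 4 : ℝ) ≤ (2 * (x * (1 - ε * x))) ^ (3 / 4 : ℝ) :=
              Real.rpow_le_rpow hx (by nlinarith) (by norm_num)
          _ = 2 ^ (3 / 4 : ℝ) * (x * (1 - ε * x)) ^ (3 / 4 : ℝ) :=
              Real.mul_rpow (by norm_num) hF
          _ ≤ _ := by
              gcongr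
              have := Real.rpow_le_rpow_of_exponent_le (show (1 : ℝ) ≤ 2 by norm_num)
                (show (3 / 4 : ℝ) ≤ 1 by norm_num)
              simpa using this
      have hA : 0 ≤ ε₀ ^ (-(1 / 4) : ℝ) := by positivity
      have hB : 0 ≤ (x * (1 - ε * x)) ^ (3 / 4 : ℝ) := by positivity
      rw [h9] at h8
      have h11 := mul_le_mul_of_nonneg_left h10 hA
      have h12 := mul_nonneg hA hB
      linarith

/-! ### Non-concentration of `F` -/

/-- A weighted arithmetic-geometric mean inequality. -/
theorem rpow_three_quarters_le {F B κ : ℝ} (hF : 0 ≤ F) (hB : 0 < B) (hκ : 0 < κ) :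
    F ^ (3 / 4 : ℝ) ≤ κ * (F * B) + (κ ^ 3)⁻¹ * (B ^ 3)⁻¹ := by
  set y := F ^ (1 / 4 : ℝ) with hy
  have hy0 : 0 ≤ y := Real.rpow_nonneg hF _
  have h4 : F = y ^ 4 := by
    rw [hy, ← Real.rpow_natCast, ← Real.rpow_mul hF]; norm_num
  have h3 : F ^ (3 / 4 : ℝ) = y ^ 3 := by
    rw [hy, ← Real.rpow_natCast, ← Real.rpow_mul hF]; norm_num
  rw [h3, h4]
  -- One of the two terms on the right suffices: the first if `κ B y ≥ 1`, the second otherwise.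
  rcases le_total 1 (κ * B * y) with h | h
  · have h1 : y ^ 3 * 1 ≤ y ^ 3 * (κ * B * y) := by gcongr
    have h2 : 0 ≤ (κ ^ 3)⁻¹ * (B ^ 3)⁻¹ := by positivity
    nlinarith
  · have h1 : (κ * B * y) ^ 3 ≤ 1 := pow_le_one₀ (by positivity) h
    have h2 : y ^ 3 ≤ (κ ^ 3)⁻¹ * (B ^ 3)⁻¹ := by
      rw [← mul_inv, ← one_div, le_div_iff₀ (by positivity)]
      nlinarith
    have h5 : 0 ≤ κ * (y ^ 4 * B) := by positivity
    linarith

theorem integrable_inv_pow {k : ℕ} (hk : 2 ≤ k) :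
    Integrable fun v : V => ((1 + ‖v‖ ^ 2) ^ k)⁻¹ := by
  have h := integrable_rpow_neg_one_add_norm_sq (E := V) (μ := volume) (r := 2 * k) (by
    simp only [finrank_euclideanSpace, Fintype.card_fin]
    have : (2 : ℝ) ≤ k := by exact_mod_cast hk
    push_cast; linarith)
  refine h.congr (Eventually.of_forall fun v => ?_)
  have e : -(2 * (k : ℝ)) / 2 = -(k : ℝ) := by ring
  simp only [e]
  rw [Real.rpow_neg (by positivity), Real.rpow_natCast]

theorem exists_orthonormalBasis_eq {n : V} (hn : ‖n‖ = 1) :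
    ∃ b : OrthonormalBasis (Fin 3) ℝ V, b 0 = n := by
  have hon : Orthonormal ℝ (({0} : Set (Fin 3)).domRestrict fun _ : Fin 3 => n) := by
    rw [orthonormal_iff_ite]
    rintro ⟨i, hi⟩ ⟨j, hj⟩
    simp only [Set.mem_singleton_iff] at hi hj
    subst hi; subst hj
    simp [Set.domRestrict, hn]
  obtain ⟨b, hb⟩ := hon.exists_orthonormalBasis_extension_of_card_eq (by simp)
  exact ⟨b, hb 0 rfl⟩

/-- The part of a slab that lies in a ball has small volume. -/
theorem volume_slab_le {n : V} (hn : ‖n‖ = 1) (t : ℝ) {R δ : ℝ} (hR : 0 ≤ R) (hδ : 0 ≤ δ) :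
    volume (closedBall (0 : V) R ∩ {w | |inner ℝ n w - t| < δ}) ≤
      ENNReal.ofReal (8 * R ^ 2 * δ) := by
  obtain ⟨b, hb0⟩ := exists_orthonormalBasis_eq hn
  set lo : Fin 3 → ℝ := ![t - δ, -R, -R] with hlo
  set hi : Fin 3 → ℝ := ![t + δ, R, R] with hhi
  have hmp : MeasurePreserving (fun v : V => (WithLp.ofLp (b.repr v) : Fin 3 → ℝ)) volume volume :=
    (PiLp.volume_preserving_ofLp (Fin 3)).comp b.measurePreserving_repr
  have hsub : closedBall (0 : V) R ∩ {w | |inner ℝ n w - t| < δ} ⊆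
      (fun v : V => (WithLp.ofLp (b.repr v) : Fin 3 → ℝ)) ⁻¹' Set.Icc lo hi := by
    rintro w ⟨hw, hs⟩
    rw [mem_closedBall, dist_zero_right] at hw
    have hs' : |inner ℝ n w - t| < δ := hs
    rw [abs_lt] at hs'
    have hc : ∀ i, |b.repr w i| ≤ R := by
      intro i
      rw [b.repr_apply_apply]
      have := abs_real_inner_le_norm (b i) w
      rw [b.norm_eq_one, one_mul] at this
      exact this.trans hw
    have h0 : b.repr w 0 = inner ℝ n w := by rw [b.repr_apply_apply, hb0]
    have h1 := abs_le.1 (hc 1)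
    have h2 := abs_le.1 (hc 2)
    constructor
    · intro i; fin_cases i
      · simp [hlo, h0]; linarith
      · simpa [hlo] using h1.1
      · simpa [hlo] using h2.1
    · intro i; fin_cases i
      · simp [hhi, h0]; linarith
      · simpa [hhi] using h1.2
      · simpa [hhi] using h2.2
  refine (measure_mono hsub).trans ?_
  rw [hmp.measure_preimage measurableSet_Icc.nullMeasurableSet, Real.volume_Icc_pi,
    ← ENNReal.ofReal_prod_of_nonneg]
  · refine ENNReal.ofReal_le_ofReal ?_
    apply le_of_eq
    simp [Fin.prod_univ_three, hlo, hhi]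
    ring
  · intro i _
    fin_cases i
    · simp [hlo, hhi]; linarith
    · simp [hlo, hhi]; linarith
    · simp [hlo, hhi]; linarith

/-- The Fermi-Dirac product `F = g (1 - ε g)`. -/
def fermi (ε : ℝ) (g : V → ℝ) (v : V) : ℝ := g v * (1 - ε * g v)

/-- Normalized densities bounded by `ε⁻¹` with a uniform lower bound on the relative entropy
`S_ε(g) - log (ε₀ / ε)`. -/
structure HasEntropyBound (ε₀ s₀ ε : ℝ) (g : V → ℝ) : Prop where
  integrable : Integrable g
  nonneg : ∀ᵐ v, 0 ≤ g v
  le_one : ∀ᵐ v, ε * g v ≤ 1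
  mass : ∫ v, g v = 1
  integrable_energy : Integrable fun v => g v * ‖v‖ ^ 2
  energy : ∫ v, g v * ‖v‖ ^ 2 = 3
  entropy : s₀ ≤ ∫ v, (entropyDensity ε (g v) - Real.log (ε₀ / ε) * g v)

theorem fermi_le {ε : ℝ} (hε : 0 < ε) {g : V → ℝ} {v : V} : fermi ε g v ≤ g v := by
  unfold fermi; nlinarith [mul_nonneg hε.le (sq_nonneg (g v))]

theorem fermi_nonneg {ε : ℝ} {g : V → ℝ} {v : V} (h0 : 0 ≤ g v) (h1 : ε * g v ≤ 1) :
    0 ≤ fermi ε g v := mul_nonneg h0 (by linarith)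

namespace HasEntropyBound

variable {ε₀ s₀ ε : ℝ} {g : V → ℝ}

theorem fermi_nonneg (h : HasEntropyBound ε₀ s₀ ε g) : ∀ᵐ v, 0 ≤ fermi ε g v := by
  filter_upwards [h.nonneg, h.le_one] with v h0 h1 using LFD.fermi_nonneg h0 h1

theorem aestronglyMeasurable_fermi (h : HasEntropyBound ε₀ s₀ ε g) :
    AEStronglyMeasurable (fermi ε g) volume :=
  h.integrable.aestronglyMeasurable.mul
    (aestronglyMeasurable_const.sub (h.integrable.aestronglyMeasurable.const_mul ε))

theorem integrable_fermi (h : HasEntropyBound ε₀ s₀ ε g) (hε : 0 < ε) :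
    Integrable (fermi ε g) := by
  refine h.integrable.mono' h.aestronglyMeasurable_fermi ?_
  filter_upwards [h.fermi_nonneg] with v hv
  rw [Real.norm_of_nonneg hv]
  exact fermi_le hε

theorem integrable_bracket (h : HasEntropyBound ε₀ s₀ ε g) :
    Integrable fun v => g v * (1 + ‖v‖ ^ 2) := by
  refine (h.integrable.add h.integrable_energy).congr (Eventually.of_forall fun v => ?_)
  simp only [Pi.add_apply]; ring

theorem integral_bracket (h : HasEntropyBound ε₀ s₀ ε g) :
    ∫ v, g v * (1 + ‖v‖ ^ 2) = 4 := by
  have : ∀ v, g v * (1 + ‖v‖ ^ 2) = g v + g v * ‖v‖ ^ 2 := fun v => by ring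
  simp_rw [this]
  rw [integral_add h.integrable h.integrable_energy, h.mass, h.energy]
  norm_num

end HasEntropyBound

theorem rpow_three_quarters_le_of_le {F B B' κ : ℝ} (hF : 0 ≤ F) (hB : 0 < B) (hB' : B ≤ B')
    (hκ : 0 < κ) : F ^ (3 / 4 : ℝ) ≤ κ * B' * F + (κ ^ 3)⁻¹ * (B ^ 3)⁻¹ := by
  have h3 : κ * (F * B) ≤ κ * (F * B') := by gcongr
  have := rpow_three_quarters_le hF hB hκ
  linarith

/-- Used off the good set: there a point lies either in the slab, where the indicator `s` is `1`, or
outside the ball, where one factor `B⁻¹` is traded for `1 / R`. The remaining `B⁻²` is still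
integrable in dimension three. -/
theorem rpow_three_quarters_le_of_or {F x B κ R s : ℝ} (hF : 0 ≤ F) (hx : F ≤ x) (hB : 1 ≤ B)
    (hκ : 0 < κ) (hR : 0 < R) (hs : 0 ≤ s) (h : 1 ≤ s ∨ R ≤ B) :
    F ^ (3 / 4 : ℝ) ≤ κ * (x * B) + (κ ^ 3)⁻¹ * ((B ^ 2)⁻¹ / R + s) := by
  have hB0 : 0 < B := by linarith
  refine (rpow_three_quarters_le hF hB0 hκ).trans ?_
  have h1 : (B ^ 3)⁻¹ ≤ (B ^ 2)⁻¹ / R + s := by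
    rcases h with h | h
    · have h2 : (B ^ 3)⁻¹ ≤ 1 := inv_le_one_of_one_le₀ (one_le_pow₀ hB)
      have h3 : 0 ≤ (B ^ 2)⁻¹ / R := by positivity
      linarith
    · have : (B ^ 3)⁻¹ ≤ (B ^ 2)⁻¹ / R := by
        rw [div_eq_mul_inv, ← mul_inv, pow_succ B 2]
        gcongr
      linarith
  gcongr

/-- The entropy bound prevents the concentration of `F` near planes and at infinity. -/
theorem exists_mass_off_slabs {ε₀ s₀ : ℝ} (hε₀ : 0 < ε₀) (hs₀ : 0 < s₀) :
    ∃ R δ c : ℝ, 1 ≤ R ∧ 0 < δ ∧ 0 < c ∧ ∀ ε : ℝ, ∀ g : V → ℝ, 0 < ε → ε ≤ ε₀ →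
      HasEntropyBound ε₀ s₀ ε g → ∀ n : V, ‖n‖ = 1 → ∀ t : ℝ,
        c ≤ ∫ v in closedBall (0 : V) R ∩ {w | δ ≤ |inner ℝ n w - t|}, fermi ε g v := by
  set C : ℝ := 20 * ε₀ ^ (-(1 / 4) : ℝ) with hC
  have hC0 : 0 < C := by positivity
  set I₃ : ℝ := ∫ v : V, ((1 + ‖v‖ ^ 2) ^ 3)⁻¹ with hI₃
  set I₂ : ℝ := ∫ v : V, ((1 + ‖v‖ ^ 2) ^ 2)⁻¹ with hI₂
  have hI₃0 : 0 ≤ I₃ := integral_nonneg fun v => by positivity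
  have hI₂0 : 0 ≤ I₂ := integral_nonneg fun v => by positivity
  -- Four errors of size `s₀ / 8` are allowed, so that half of `s₀` must come from the mass of `F`
  -- on the good set. `κ` pays for the weighted mass `∫ g (1 + |v|²) = 4`, `K` for the remainder on
  -- the good set, `R` for the exterior of the ball and `δ` for the slab. `R` and `δ` are chosen
  -- after `κ` because `κ⁻³` multiplies their errors.
  obtain ⟨κ, hκ⟩ : ∃ κ : ℝ, κ = s₀ / (32 * C) := ⟨_, rfl⟩
  have hκ0 : 0 < κ := by rw [hκ]; positivity
  have hκ1 : C * (κ * 4) = s₀ / 8 := by rw [hκ]; field_simp; norm_num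
  obtain ⟨K, hK1, hK⟩ : ∃ K : ℝ, 1 ≤ K ∧ C * ((K ^ 3)⁻¹ * I₃) ≤ s₀ / 8 := by
    refine ⟨1 + 8 * C * I₃ / s₀, by
      have : 0 ≤ 8 * C * I₃ / s₀ := by positivity
      linarith, ?_⟩
    set K := 1 + 8 * C * I₃ / s₀ with hKdef
    have h0 : 0 ≤ 8 * C * I₃ / s₀ := by positivity
    have h1 : 1 ≤ K := by linarith
    have h2 : K ≤ K ^ 3 := by nlinarith [mul_nonneg (sub_nonneg.2 h1) (sub_nonneg.2 h1)]
    have h3 : 8 * C * I₃ / s₀ ≤ K ^ 3 := by linarith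
    rw [div_le_iff₀ hs₀] at h3
    have h4 : 0 < K ^ 3 := by positivity
    rw [← mul_assoc, mul_comm C, mul_assoc, inv_mul_le_iff₀ h4]
    linarith
  obtain ⟨R, hR1, hR⟩ : ∃ R : ℝ, 1 ≤ R ∧ C * ((κ ^ 3)⁻¹ * (I₂ / R)) ≤ s₀ / 8 := by
    set A := 8 * C * (κ ^ 3)⁻¹ * I₂ / s₀ with hA
    have h0 : 0 ≤ A := by positivity
    refine ⟨1 + A, by linarith, ?_⟩
    have h3 : A ≤ 1 + A := by linarith
    rw [hA, div_le_iff₀ hs₀, ← hA] at h3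
    have : C * ((κ ^ 3)⁻¹ * (I₂ / (1 + A))) = C * (κ ^ 3)⁻¹ * I₂ / (1 + A) := by ring
    rw [this, div_le_iff₀ (by linarith)]
    linarith
  obtain ⟨δ, hδ0, hδ⟩ : ∃ δ : ℝ, 0 < δ ∧ C * ((κ ^ 3)⁻¹ * (8 * R ^ 2 * δ)) = s₀ / 8 := by
    refine ⟨s₀ / (64 * C * (κ ^ 3)⁻¹ * R ^ 2), by positivity, ?_⟩
    field_simp; norm_num
  have hR0 : 0 < R := by linarith
  have hK0 : 0 < K := by linarith
  refine ⟨R, δ, s₀ / (2 * C * K * (1 + R ^ 2)), hR1, hδ0, by positivity, ?_⟩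
  intro ε g hε hεε₀ h n hn t
  set P : Set V := closedBall (0 : V) R ∩ {w | δ ≤ |inner ℝ n w - t|} with hP
  set S : Set V := closedBall (0 : V) R ∩ {w | |inner ℝ n w - t| < δ} with hS
  have hcont : Continuous fun w : V => |inner ℝ n w - t| := by fun_prop
  have hPm : MeasurableSet P :=
    measurableSet_closedBall.inter (measurableSet_le measurable_const hcont.measurable)
  have hSm : MeasurableSet S :=
    measurableSet_closedBall.inter (measurableSet_lt hcont.measurable measurable_const)
  have hSv : volume S ≤ ENNReal.ofReal (8 * R ^ 2 * δ) := volume_slab_le hn t hR0.le hδ0.le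
  have hSfin : volume S ≠ ⊤ := (hSv.trans_lt ENNReal.ofReal_lt_top).ne
  have hSr : ∫ v, S.indicator (fun _ => (1 : ℝ)) v ≤ 8 * R ^ 2 * δ := by
    rw [integral_indicator hSm]
    simp only [integral_const, smul_eq_mul, mul_one, measureReal_restrict_apply_univ]
    exact ENNReal.toReal_le_of_le_ofReal (by positivity) hSv
  have hi1 : Integrable (P.indicator (fermi ε g)) := (h.integrable_fermi hε).indicator hPm
  have hi2 := integrable_inv_pow (k := 3) (by norm_num)
  have hi3 := integrable_inv_pow (k := 2) (by norm_num)
  have hi4 := h.integrable_bracket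
  have hi5 : Integrable (S.indicator fun _ => (1 : ℝ)) :=
    (integrable_indicator_iff hSm).2 (integrableOn_const hSfin)
  have hj1 : Integrable fun v => C * (K * (1 + R ^ 2) * P.indicator (fermi ε g) v) :=
    (hi1.const_mul _).const_mul _
  have hj2 : Integrable fun v : V => C * ((K ^ 3)⁻¹ * ((1 + ‖v‖ ^ 2) ^ 3)⁻¹) :=
    (hi2.const_mul _).const_mul _
  have hj3 : Integrable fun v : V => C * (κ * (g v * (1 + ‖v‖ ^ 2))) :=
    (hi4.const_mul _).const_mul _
  have hj4 : Integrable fun v : V => C * ((κ ^ 3)⁻¹ * (((1 + ‖v‖ ^ 2) ^ 2)⁻¹ / R)) :=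
    ((hi3.div_const _).const_mul _).const_mul _
  have hj5 : Integrable fun v : V => C * ((κ ^ 3)⁻¹ * S.indicator (fun _ => (1 : ℝ)) v) :=
    (hi5.const_mul _).const_mul _
  have hTi := (((hj1.add hj2).add hj3).add hj4).add hj5
  have hTint := integral_add' (((hj1.add hj2).add hj3).add hj4) hj5
  rw [integral_add' ((hj1.add hj2).add hj3) hj4, integral_add' (hj1.add hj2) hj3,
    integral_add' hj1 hj2] at hTint
  simp only [integral_const_mul, integral_div, h.integral_bracket, integral_indicator hPm]
    at hTint
  rw [← hI₂, ← hI₃] at hTint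
  set T : V → ℝ := _ + _ with hT
  have hpt : ∀ᵐ v, entropyDensity ε (g v) - Real.log (ε₀ / ε) * g v ≤ T v := by
    filter_upwards [h.nonneg, h.le_one] with v h0 h1
    have hF := LFD.fermi_nonneg h0 h1
    have hB : 1 ≤ 1 + ‖v‖ ^ 2 := by nlinarith [sq_nonneg ‖v‖]
    refine (entropyDensity_le hε hεε₀ h0 h1).trans ?_
    have hT' : T v = C * (K * (1 + R ^ 2) * P.indicator (fermi ε g) v +
      (K ^ 3)⁻¹ * ((1 + ‖v‖ ^ 2) ^ 3)⁻¹ + κ * (g v * (1 + ‖v‖ ^ 2)) +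
      (κ ^ 3)⁻¹ * (((1 + ‖v‖ ^ 2) ^ 2)⁻¹ / R) +
      (κ ^ 3)⁻¹ * S.indicator (fun _ => (1 : ℝ)) v) := by
      simp only [hT, Pi.add_apply, mul_add]
    rw [hT']
    refine mul_le_mul_of_nonneg_left ?_ hC0.le
    change fermi ε g v ^ (3 / 4 : ℝ) ≤ _
    have hs : 0 ≤ S.indicator (fun _ => (1 : ℝ)) v :=
      Set.indicator_nonneg (fun _ _ => zero_le_one) _
    by_cases hvP : v ∈ P
    · rw [Set.indicator_of_mem hvP]
      have hv : ‖v‖ ≤ R := by simpa using hvP.1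
      have hv2 : 1 + ‖v‖ ^ 2 ≤ 1 + R ^ 2 := by gcongr
      have h2 := rpow_three_quarters_le_of_le hF (by linarith) hv2 hK0
      have h4 : 0 ≤ κ * (g v * (1 + ‖v‖ ^ 2)) := by positivity
      have h5 : 0 ≤ (κ ^ 3)⁻¹ * (((1 + ‖v‖ ^ 2) ^ 2)⁻¹ / R) := by positivity
      have h6 := mul_nonneg (inv_nonneg.2 (pow_nonneg hκ0.le 3)) hs
      linarith
    · rw [Set.indicator_of_notMem hvP]
      have h4 : 0 ≤ (K ^ 3)⁻¹ * ((1 + ‖v‖ ^ 2) ^ 3)⁻¹ := by positivity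
      have h7 : 1 ≤ S.indicator (fun _ => (1 : ℝ)) v ∨ R ≤ 1 + ‖v‖ ^ 2 := by
        by_cases hvR : ‖v‖ ≤ R
        · have hvR' : v ∈ closedBall (0 : V) R := by simpa using hvR
          have hvS : v ∈ S := ⟨hvR', lt_of_not_ge (a := |inner ℝ n v - t|) fun hc => hvP ⟨hvR', hc⟩⟩
          rw [Set.indicator_of_mem hvS]
          exact Or.inl le_rfl
        · exact Or.inr (by nlinarith [not_le.1 hvR])
      have h8 := rpow_three_quarters_le_of_or hF (fermi_le hε) hB hκ0 hR0 hs h7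
      rw [mul_add] at h8
      linarith
  -- A non-integrable function has Bochner integral `0`, which the bound `s₀ > 0` excludes.
  have hθi : Integrable fun v => entropyDensity ε (g v) - Real.log (ε₀ / ε) * g v := by
    by_contra hni
    have := h.entropy
    rw [integral_undef hni] at this
    linarith
  have hmain := h.entropy.trans (integral_mono_ae hθi hTi hpt)
  rw [hTint] at hmain
  have hS2 : C * ((κ ^ 3)⁻¹ * ∫ v, S.indicator (fun _ => (1 : ℝ)) v) ≤ s₀ / 8 := by
    rw [← hδ]; gcongr
  have hfin : s₀ / 2 ≤ C * (K * (1 + R ^ 2) * ∫ v in P, fermi ε g v) := by linarith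
  rw [div_le_iff₀ (by positivity)]
  linarith

/-! ### Test fields and integration by parts -/

/-- A bound for the pairing of a weak gradient with a compactly supported vector field. -/
theorem IsWeakGradient.abs_integral_inner_le {u : V → ℝ} {G : V → V} (h : IsWeakGradient u G)
    (hu : Integrable u) {Φ : V → V} (hΦ : ContDiff ℝ (⊤ : ℕ∞) Φ) (hc : HasCompactSupport Φ)
    {L : ℝ} (hL : ∀ w, ‖fderiv ℝ Φ w‖ ≤ L) :
    Integrable (fun w => inner ℝ (G w) (Φ w)) ∧
      |∫ w, inner ℝ (G w) (Φ w)| ≤ 3 * L * ∫ w, |u w| := by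
  set b : Fin 3 → V := fun j => EuclideanSpace.single j (1 : ℝ) with hb
  set φ : Fin 3 → V → ℝ := fun j w => inner ℝ (b j) (Φ w) with hφ
  have hφd : ∀ j, ContDiff ℝ (⊤ : ℕ∞) (φ j) := fun j => contDiff_const.inner ℝ hΦ
  have hφc : ∀ j, HasCompactSupport (φ j) := fun j =>
    hc.comp_left (g := fun y => inner ℝ (b j) y) (inner_zero_right _)
  have hsum : ∀ w, inner ℝ (G w) (Φ w) = ∑ j, inner ℝ (G w) (b j) * φ j w := by
    intro w
    simp only [hb, hφ, PiLp.inner_apply, Fin.sum_univ_three]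
    simp [mul_comm]
  have hi : ∀ j, Integrable fun w => inner ℝ (G w) (b j) * φ j w := fun j =>
    integrable_inner_mul h.locInt_grad (b j) (hφd j).continuous (hφc j)
  have hder : ∀ j w, |fderiv ℝ (φ j) w (b j)| ≤ L := by
    intro j w
    have h1 : HasFDerivAt (φ j) ((innerSL ℝ (b j)).comp (fderiv ℝ Φ w)) w :=
      (innerSL ℝ (b j)).hasFDerivAt.comp w
        ((hΦ.differentiable (by simp)) w).hasFDerivAt
    have hb1 : ‖b j‖ = 1 := by simp [hb]
    rw [h1.fderiv, ContinuousLinearMap.comp_apply, innerSL_apply_apply]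
    calc |inner ℝ (b j) (fderiv ℝ Φ w (b j))| ≤ ‖b j‖ * ‖fderiv ℝ Φ w (b j)‖ :=
          abs_real_inner_le_norm _ _
      _ ≤ ‖b j‖ * (‖fderiv ℝ Φ w‖ * ‖b j‖) := by
          gcongr; exact (fderiv ℝ Φ w).le_opNorm _
      _ ≤ L := by rw [hb1]; simpa using hL w
  have hj : ∀ j, |∫ w, inner ℝ (G w) (b j) * φ j w| ≤ L * ∫ w, |u w| := by
    intro j
    have h1 := h.integral_eq (φ j) (hφd j) (hφc j) (b j)
    have h2 : |∫ w, inner ℝ (G w) (b j) * φ j w| = |∫ w, u w * fderiv ℝ (φ j) w (b j)| := by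
      rw [h1, abs_neg]
    rw [h2, ← integral_const_mul, ← Real.norm_eq_abs]
    refine norm_integral_le_of_norm_le (hu.abs.const_mul L) (Eventually.of_forall fun w => ?_)
    rw [norm_mul, mul_comm, Real.norm_eq_abs, Real.norm_eq_abs]
    exact mul_le_mul_of_nonneg_right (hder j w) (abs_nonneg _)
  simp_rw [hsum]
  refine ⟨integrable_finsetSum _ fun j _ => hi j, ?_⟩
  rw [integral_finsetSum _ fun j _ => hi j]
  refine (Finset.abs_sum_le_sum_abs _ _).trans ?_
  refine (Finset.sum_le_sum fun j _ => hj j).trans ?_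
  simp only [Finset.sum_const, Finset.card_univ, Fintype.card_fin, nsmul_eq_mul]
  apply le_of_eq; push_cast; ring

/-- `|z|² Π(z) x`. -/
def scaledProj (z x : V) : V := ‖z‖ ^ 2 • x - inner ℝ z x • z

/-- `|z|² |Π(z) x|²`. -/
def wedgeSq (z x : V) : ℝ := ‖z‖ ^ 2 * ‖x‖ ^ 2 - inner ℝ z x ^ 2

/-- The component of `z` orthogonal to a unit vector `u`. -/
def perp (u z : V) : V := z - inner ℝ u z • u

theorem wedgeSq_nonneg (z x : V) : 0 ≤ wedgeSq z x := by
  unfold wedgeSq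
  have h := abs_real_inner_le_norm z x
  have h2 := pow_le_pow_left₀ (abs_nonneg _) h 2
  rw [sq_abs, mul_pow] at h2
  linarith

theorem norm_sq_mul_orthProj (z x : V) : ‖z‖ ^ 2 * ‖orthProj z x‖ ^ 2 = wedgeSq z x := by
  by_cases hz : z = 0
  · simp [hz, wedgeSq]
  have h0 : ‖z‖ ≠ 0 := norm_ne_zero_iff.2 hz
  rw [orthProj, norm_sub_sq_real, inner_smul_right, norm_smul, Real.norm_eq_abs, mul_pow, sq_abs,
    real_inner_comm z x, wedgeSq]
  field_simp
  ring

/-- Expansion of a quadratic form. The last term is nonnegative and will be dropped; the middle one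
is linear in `y`, hence in `∇g(w)`. -/
theorem wedgeSq_sub (z x y : V) :
    wedgeSq z (x - y) = wedgeSq z x - 2 * inner ℝ y (scaledProj z x) + wedgeSq z y := by
  simp only [wedgeSq, scaledProj, norm_sub_sq_real, inner_sub_right, inner_smul_right]
  rw [real_inner_comm x y, real_inner_comm z y]
  ring

theorem scaledProj_smul (z x : V) (a : ℝ) : scaledProj z (a • x) = a • scaledProj z x := by
  simp only [scaledProj, inner_smul_right, smul_sub, smul_smul]
  congr 2; ring

theorem wedgeSq_smul (z x : V) (a : ℝ) : wedgeSq z (a • x) = a ^ 2 * wedgeSq z x := by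
  simp only [wedgeSq, inner_smul_right, norm_smul, Real.norm_eq_abs, mul_pow, sq_abs]
  ring

/-- The Gram determinant of `z` and `u` is symmetric, so the size of `|z| Π(z)u` is the distance
from `z` to the line `ℝu`. This turns coercivity of the projection into the question whether `F`
concentrates near lines. -/
theorem norm_perp_sq {u : V} (hu : ‖u‖ = 1) (z : V) : ‖perp u z‖ ^ 2 = wedgeSq z u := by
  simp only [perp, wedgeSq, norm_sub_sq_real, inner_smul_right, norm_smul, Real.norm_eq_abs,
    mul_pow, sq_abs, hu]
  rw [real_inner_comm z u]
  ring

theorem norm_perp_le {u : V} (hu : ‖u‖ = 1) (z : V) : ‖perp u z‖ ≤ ‖z‖ := by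
  refine le_of_sq_le_sq ?_ (norm_nonneg _)
  rw [norm_perp_sq hu, wedgeSq, hu]
  nlinarith [sq_nonneg (inner ℝ z u)]

theorem perp_sub (u z w : V) : perp u (z - w) = perp u z - perp u w := by
  simp only [perp, inner_sub_right, sub_smul]
  abel

theorem norm_scaledProj {u : V} (hu : ‖u‖ = 1) (z : V) :
    ‖scaledProj z u‖ = ‖z‖ * ‖perp u z‖ := by
  have h : ‖scaledProj z u‖ ^ 2 = (‖z‖ * ‖perp u z‖) ^ 2 := by
    rw [mul_pow, norm_perp_sq hu]
    simp only [scaledProj, wedgeSq, norm_sub_sq_real, inner_smul_right, inner_smul_left,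
      norm_smul, Real.norm_eq_abs, mul_pow, sq_abs, hu]
    rw [real_inner_comm z u]
    simp
    ring
  exact (sq_eq_sq₀ (norm_nonneg _) (by positivity)).1 h

/-- The factor `|z|²` removes the singularity of the projection at `w = v`: the field is quadratic
in `w`, hence can be used as a test function. -/
theorem contDiff_scaledProj (v u : V) :
    ContDiff ℝ (⊤ : ℕ∞) fun w : V => scaledProj (v - w) u := by
  unfold scaledProj
  have h1 : ContDiff ℝ (⊤ : ℕ∞) fun w : V => v - w := contDiff_const.sub contDiff_id
  exact ((h1.norm_sq ℝ).smul contDiff_const).sub ((h1.inner ℝ contDiff_const).smul h1)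

theorem norm_fderiv_scaledProj_le {u : V} (hu : ‖u‖ = 1) (v w : V) :
    ‖fderiv ℝ (fun w : V => scaledProj (v - w) u) w‖ ≤ 4 * ‖v - w‖ := by
  have h1 : HasFDerivAt (fun w : V => v - w) (-ContinuousLinearMap.id ℝ V) w :=
    (hasFDerivAt_id w).const_sub v
  have h2 := (h1.norm_sq.smul_const u).sub ((h1.inner ℝ (hasFDerivAt_const u w)).smul h1)
  have h3 : fderiv ℝ (fun w : V => scaledProj (v - w) u) w = _ := h2.fderiv
  rw [h3]
  refine ContinuousLinearMap.opNorm_le_bound _ (by positivity) fun e => ?_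
  set z := v - w with hz
  have e1 : ‖inner ℝ z e‖ ≤ ‖z‖ * ‖e‖ := norm_inner_le_norm _ _
  have e2 : ‖inner ℝ e u‖ ≤ ‖e‖ := by simpa [hu] using norm_inner_le_norm (𝕜 := ℝ) e u
  have e3 : ‖inner ℝ z u‖ ≤ ‖z‖ := by simpa [hu] using norm_inner_le_norm (𝕜 := ℝ) z u
  have key : ‖(-(2 * inner ℝ z e)) • u - (inner ℝ z u • (-e) + (-inner ℝ e u) • z)‖ ≤
      4 * ‖z‖ * ‖e‖ := by
    refine (norm_sub_le _ _).trans ?_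
    refine (add_le_add_right (norm_add_le _ _) _).trans ?_
    simp only [norm_smul, norm_neg, hu, norm_mul]
    have t1 : ‖inner ℝ z u‖ * ‖e‖ ≤ ‖z‖ * ‖e‖ := by gcongr
    have t2 : ‖inner ℝ e u‖ * ‖z‖ ≤ ‖e‖ * ‖z‖ := by gcongr
    norm_num
    rw [← Real.norm_eq_abs, ← Real.norm_eq_abs, ← Real.norm_eq_abs]
    linarith
  refine le_trans (le_of_eq ?_) key
  congr 1
  simp

/-- A smooth cutoff, equal to `1` on the ball of radius `R`. -/
def cutoff {R : ℝ} (hR : 0 < R) : ContDiffBump (0 : V) where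
  rIn := R
  rOut := 2 * R
  rIn_pos := hR
  rIn_lt_rOut := by linarith

section cutoff

variable {R : ℝ} (hR : 0 < R)

theorem cutoff_contDiff : ContDiff ℝ (⊤ : ℕ∞) (cutoff hR) := (cutoff hR).contDiff

theorem cutoff_tsupport : tsupport (cutoff hR) = closedBall 0 (2 * R) := (cutoff hR).tsupport_eq

theorem cutoff_eq_zero {w : V} (hw : w ∉ closedBall (0 : V) (2 * R)) : cutoff hR w = 0 :=
  image_eq_zero_of_notMem_tsupport (by rwa [cutoff_tsupport])

theorem cutoff_eq_one {w : V} (hw : w ∈ closedBall (0 : V) R) : cutoff hR w = 1 :=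
  (cutoff hR).one_of_mem_closedBall hw

theorem exists_norm_fderiv_cutoff_le : ∃ B, 0 ≤ B ∧ ∀ w, ‖fderiv ℝ (cutoff hR) w‖ ≤ B := by
  have h1 : ContDiff ℝ 1 (cutoff hR) := (cutoff hR).contDiff
  obtain ⟨B, hB⟩ := (h1.continuous_fderiv one_ne_zero).bounded_above_of_compact_support
    ((cutoff hR).hasCompactSupport.fderiv ℝ)
  exact ⟨B, (norm_nonneg _).trans (hB 0), hB⟩

end cutoff

/-- The test field `χ(w) |v - w|² Π(v - w) u`. -/
def testField {R : ℝ} (hR : 0 < R) (v u w : V) : V := cutoff hR w • scaledProj (v - w) u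

theorem testField_contDiff {R : ℝ} (hR : 0 < R) (v u : V) :
    ContDiff ℝ (⊤ : ℕ∞) (testField hR v u) :=
  (cutoff_contDiff hR).smul (contDiff_scaledProj v u)

theorem testField_hasCompactSupport {R : ℝ} (hR : 0 < R) (v u : V) :
    HasCompactSupport (testField hR v u) :=
  (cutoff hR).hasCompactSupport.smul_right

/-- The growth is `(1 + |v|)(1 + |perp u v|)` instead of `(1 + |v|)²`, because `|scaledProj z u| =
|z| |perp u z|` when the derivative falls on the cutoff, and the derivative of `scaledProj` is only
`O(|z|)`. The factor `1 + |perp u v|` will be absorbed by the coercive term. -/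
theorem norm_fderiv_testField_le {R B : ℝ} (hR : 0 < R) (hB0 : 0 ≤ B)
    (hB : ∀ w, ‖fderiv ℝ (cutoff hR) w‖ ≤ B) {u : V} (hu : ‖u‖ = 1) (v w : V) :
    ‖fderiv ℝ (testField hR v u) w‖ ≤
      (B * (1 + 2 * R) ^ 2 + 4 * (1 + 2 * R)) * ((1 + ‖v‖) * (1 + ‖perp u v‖)) := by
  have hpos : 0 ≤ (B * (1 + 2 * R) ^ 2 + 4 * (1 + 2 * R)) * ((1 + ‖v‖) * (1 + ‖perp u v‖)) := by
    positivity
  by_cases hw : w ∈ closedBall (0 : V) (2 * R)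
  · have hw' : ‖w‖ ≤ 2 * R := by simpa using hw
    have hc : DifferentiableAt ℝ (cutoff hR) w :=
      (cutoff_contDiff hR).differentiable (by simp) w
    have hs : DifferentiableAt ℝ (fun w : V => scaledProj (v - w) u) w :=
      (contDiff_scaledProj v u).differentiable (by simp) w
    have h1 : fderiv ℝ (testField hR v u) w = _ := (hc.hasFDerivAt.smul hs.hasFDerivAt).fderiv
    rw [h1]
    refine (norm_add_le _ _).trans ?_
    have hz : ‖v - w‖ ≤ (1 + 2 * R) * (1 + ‖v‖) := by
      refine (norm_sub_le _ _).trans ?_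
      nlinarith [norm_nonneg v, mul_nonneg hR.le (norm_nonneg v)]
    have hp : ‖perp u (v - w)‖ ≤ (1 + 2 * R) * (1 + ‖perp u v‖) := by
      rw [perp_sub]
      refine (norm_sub_le _ _).trans ?_
      have := norm_perp_le hu w
      nlinarith [norm_nonneg (perp u v), mul_nonneg hR.le (norm_nonneg (perp u v))]
    have hA : ‖cutoff hR w • fderiv ℝ (fun w : V => scaledProj (v - w) u) w‖ ≤
        1 * (4 * ‖v - w‖) := by
      rw [norm_smul, Real.norm_of_nonneg (cutoff hR).nonneg]
      exact mul_le_mul (cutoff hR).le_one (norm_fderiv_scaledProj_le hu v w) (norm_nonneg _)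
        zero_le_one
    have hBd : ‖(fderiv ℝ (cutoff hR) w).smulRight (scaledProj (v - w) u)‖ ≤
        B * (‖v - w‖ * ‖perp u (v - w)‖) := by
      rw [ContinuousLinearMap.norm_smulRight_apply, norm_scaledProj hu]
      gcongr
      exact hB w
    refine (add_le_add hA hBd).trans ?_
    have h2 : B * (‖v - w‖ * ‖perp u (v - w)‖) ≤
        B * (((1 + 2 * R) * (1 + ‖v‖)) * ((1 + 2 * R) * (1 + ‖perp u v‖))) := by gcongr
    have h3 : (1 + 2 * R) * (1 + ‖v‖) ≤ (1 + 2 * R) * (1 + ‖v‖) * (1 + ‖perp u v‖) :=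
      le_mul_of_one_le_right (by positivity) (by linarith [norm_nonneg (perp u v)])
    nlinarith
  · have : w ∉ tsupport (fderiv ℝ (testField hR v u)) := by
      intro hmem
      refine hw ?_
      rw [← cutoff_tsupport hR]
      exact closure_mono (Function.support_smul_subset_left _ _)
        (tsupport_fderiv_subset ℝ hmem)
    rw [image_eq_zero_of_notMem_tsupport this, norm_zero]
    exact hpos

/-! ### Pointwise coercivity -/

/-- Lower bound of the weighted orthogonal displacement. -/
theorem HasEntropyBound.le_integral_perp {ε₀ s₀ ε : ℝ} {g : V → ℝ}
    (h : HasEntropyBound ε₀ s₀ ε g) (hε : 0 < ε) {R δ c : ℝ} (hR : 0 < R) (hδ : 0 < δ)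
    (hc : ∀ n : V, ‖n‖ = 1 → ∀ t : ℝ,
        c ≤ ∫ w in closedBall (0 : V) R ∩ {w | δ ≤ |inner ℝ n w - t|}, fermi ε g w)
    {u : V} (hu : ‖u‖ = 1) (v : V) :
    Integrable (fun w => fermi ε g w * cutoff hR w * ‖perp u (v - w)‖ ^ 2) ∧
    c / ((1 + R) / δ + 1) ^ 2 * (1 + ‖perp u v‖) ^ 2 ≤
      ∫ w, fermi ε g w * cutoff hR w * ‖perp u (v - w)‖ ^ 2 := by
  have hpc : Continuous fun w : V => cutoff hR w * ‖perp u (v - w)‖ ^ 2 := by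
    refine (cutoff hR).continuous.mul (Continuous.pow (Continuous.norm ?_) 2)
    unfold perp; fun_prop
  have hpcs : HasCompactSupport fun w : V => cutoff hR w * ‖perp u (v - w)‖ ^ 2 :=
    (cutoff hR).hasCompactSupport.mul_right
  have hint : Integrable fun w => fermi ε g w * cutoff hR w * ‖perp u (v - w)‖ ^ 2 := by
    simp_rw [mul_assoc]
    exact (h.integrable_fermi hε).locallyIntegrable.integrable_smul_right_of_hasCompactSupport
      hpc hpcs
  refine ⟨hint, ?_⟩
  -- For a unit vector `n` orthogonal to `u`, `n · perp u (v - w) = n · v - n · w`. Hence off the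
  -- slab of half-width `δ` around the plane through `v` normal to `n`, the displacement is at least
  -- `δ`.
  obtain ⟨b, hb⟩ := exists_orthonormalBasis_eq hu
  have hn : ‖b 1‖ = 1 := b.norm_eq_one 1
  have hun : inner ℝ (b 1) u = 0 := by
    rw [← hb]; exact b.inner_eq_zero (by decide)
  set P : Set V := closedBall (0 : V) R ∩ {w | δ ≤ |inner ℝ (b 1) w - inner ℝ (b 1) v|} with hP
  have hPm : MeasurableSet P := by
    refine measurableSet_closedBall.inter (measurableSet_le measurable_const ?_)
    have : Continuous fun w : V => |inner ℝ (b 1) w - inner ℝ (b 1) v| := by fun_prop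
    exact this.measurable
  -- With `d = |perp u (v - w)| ≥ δ` and `|w| ≤ R`, `1 + |perp u v| ≤ 1 + R + d ≤ k d`.
  set k := (1 + R) / δ + 1 with hk
  have hk0 : 0 < k := by positivity
  have hcP := hc (b 1) hn (inner ℝ (b 1) v)
  have hstep : (1 + ‖perp u v‖) ^ 2 / k ^ 2 * ∫ w in P, fermi ε g w ≤
      ∫ w, fermi ε g w * cutoff hR w * ‖perp u (v - w)‖ ^ 2 := by
    rw [← integral_const_mul, ← integral_indicator hPm]
    refine integral_mono_ae (((h.integrable_fermi hε).const_mul _).indicator hPm) hint ?_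
    filter_upwards [h.fermi_nonneg] with w hF
    by_cases hw : w ∈ P
    · rw [Set.indicator_of_mem hw]
      have hwR : ‖w‖ ≤ R := by simpa using hw.1
      have hwδ : δ ≤ |inner ℝ (b 1) w - inner ℝ (b 1) v| := hw.2
      rw [cutoff_eq_one hR hw.1, mul_one, mul_comm]
      refine mul_le_mul_of_nonneg_left ?_ hF
      rw [← div_pow]
      refine pow_le_pow_left₀ (by positivity) ?_ 2
      rw [div_le_iff₀ hk0]
      have h1 : δ ≤ ‖perp u (v - w)‖ := by
        have h2 : inner ℝ (b 1) (perp u (v - w)) = inner ℝ (b 1) v - inner ℝ (b 1) w := by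
          simp only [perp, inner_sub_right, inner_smul_right, hun]; ring
        have h3 := abs_real_inner_le_norm (b 1) (perp u (v - w))
        rw [h2, hn, one_mul, abs_sub_comm] at h3
        exact hwδ.trans h3
      have h4 : ‖perp u v‖ ≤ ‖perp u (v - w)‖ + R := by
        have h5 : perp u v = perp u (v - w) + perp u w := by rw [perp_sub]; abel
        rw [h5]
        exact (norm_add_le _ _).trans (by linarith [norm_perp_le hu w])
      have h6 : 1 + R ≤ (1 + R) / δ * ‖perp u (v - w)‖ := by
        rw [div_mul_eq_mul_div, le_div_iff₀ hδ]
        gcongr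
      rw [hk]
      linarith
    · rw [Set.indicator_of_notMem hw]
      exact mul_nonneg (mul_nonneg hF (cutoff hR).nonneg) (by positivity)
  refine le_trans ?_ hstep
  rw [div_mul_eq_mul_div, mul_comm c, ← div_mul_eq_mul_div]
  gcongr

/-- The density in `w` of the entropy production for a given value `x` of `∇g(v) / F(v)`,
without its weight. -/
def productionDensity (ε : ℝ) (g : V → ℝ) (G : V → V) (v x w : V) : ℝ :=
  fermi ε g w * (‖v - w‖ ^ 2 * ‖orthProj (v - w) (x - (fermi ε g w)⁻¹ • G w)‖ ^ 2)

/-- `F` vanishes only on the level sets `g = 0` and `g = ε⁻¹`. Thus `∇g = F (∇g / F)` almost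
everywhere, even where the quotient is the default value `0`. -/
theorem IsWeakGradient.ae_eq_zero_of_fermi {ε : ℝ} (hε : 0 < ε) {g : V → ℝ} {G : V → V}
    (h : IsWeakGradient g G) : ∀ᵐ w, fermi ε g w = 0 → G w = 0 := by
  filter_upwards [h.ae_eq_zero_of_level 0, h.ae_eq_zero_of_level ε⁻¹] with w h0 h1 hF
  rcases mul_eq_zero.1 hF with h2 | h2
  · exact h0 h2
  · refine h1 ?_
    field_simp
    linarith

/-- Pointwise control of `∇g / F` by the entropy production. -/
theorem exists_norm_sq_le {ε₀ s₀ : ℝ} (hε₀ : 0 < ε₀) (hs₀ : 0 < s₀) :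
    ∃ R C : ℝ, 1 ≤ R ∧ 0 < C ∧ ∀ ε : ℝ, ∀ g : V → ℝ, ∀ G : V → V, 0 < ε → ε ≤ ε₀ →
      HasEntropyBound ε₀ s₀ ε g → IsWeakGradient g G → ∀ v x : V,
        IntegrableOn (productionDensity ε g G v x) (closedBall 0 (2 * R)) →
        ‖x‖ ^ 2 ≤ C * ((1 + ‖v‖ ^ 2) +
          ∫ w in closedBall (0 : V) (2 * R), productionDensity ε g G v x w) := by
  obtain ⟨R, δ, c, hR1, hδ, hc0, hc⟩ := exists_mass_off_slabs hε₀ hs₀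
  have hR : 0 < R := by linarith
  obtain ⟨B, hB0, hB⟩ := exists_norm_fderiv_cutoff_le hR
  set c₁ := c / ((1 + R) / δ + 1) ^ 2 with hc₁
  have hc₁0 : 0 < c₁ := by positivity
  set K := 3 * (B * (1 + 2 * R) ^ 2 + 4 * (1 + 2 * R)) with hK
  have hK0 : 0 < K := by positivity
  refine ⟨R, 2 / c₁ + 8 * K ^ 2 / c₁ ^ 2, hR1, by positivity, ?_⟩
  intro ε g G hε hεε₀ h hG v x hj
  set J := ∫ w in closedBall (0 : V) (2 * R), productionDensity ε g G v x w with hJ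
  have hJ0 : 0 ≤ J := by
    refine integral_nonneg_of_ae (ae_restrict_of_ae ?_)
    filter_upwards [h.fermi_nonneg] with w hF
    exact mul_nonneg hF (by positivity)
  by_cases hx : x = 0
  · rw [hx, norm_zero, zero_pow two_ne_zero]
    positivity
  set l := ‖x‖ with hl
  have hl0 : 0 < l := norm_pos_iff.2 hx
  obtain ⟨u, hu, hxu⟩ : ∃ u : V, ‖u‖ = 1 ∧ x = l • u := by
    refine ⟨l⁻¹ • x, ?_, by rw [smul_smul, mul_inv_cancel₀ hl0.ne', one_smul]⟩
    rw [norm_smul, norm_inv, Real.norm_of_nonneg hl0.le, inv_mul_cancel₀ hl0.ne']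
  obtain ⟨hQi, hQ⟩ := h.le_integral_perp hε hR hδ (hc ε g hε hεε₀ h) hu v
  obtain ⟨hTi, hT⟩ := hG.abs_integral_inner_le h.integrable (testField_contDiff hR v u)
    (testField_hasCompactSupport hR v u) (norm_fderiv_testField_le hR hB0 hB hu v)
  have hmass : ∫ w, |g w| = 1 := by
    rw [← h.mass]
    refine integral_congr_ae ?_
    filter_upwards [h.nonneg] with w hw using abs_of_nonneg hw
  rw [hmass, mul_one, ← mul_assoc, ← hK] at hT
  set A := ‖perp u v‖ with hA
  set Q := ∫ w, fermi ε g w * cutoff hR w * ‖perp u (v - w)‖ ^ 2 with hQdef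
  set Z := ∫ w, inner ℝ (G w) (testField hR v u w) with hZ
  set D := (closedBall (0 : V) (2 * R)).indicator (productionDensity ε g G v x) with hD
  have hDi : Integrable D := (integrable_indicator_iff measurableSet_closedBall).2 hj
  have hDint : ∫ w, D w = J := integral_indicator measurableSet_closedBall
  -- Pointwise in `w`: expand the square, drop the nonnegative term in `k`, multiply by `F χ`, and
  -- use `F k = ∇g(w)`. No `1 / F` is left, so the cross term `Z` is a pairing of a weak gradient
  -- with a smooth field.
  have hmain : l ^ 2 * Q ≤ J + 2 * l * Z := by
    rw [← hDint, hQdef, hZ, ← integral_const_mul, ← integral_const_mul,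
      ← integral_add hDi (hTi.const_mul _)]
    refine integral_mono_ae (hQi.const_mul _) (hDi.add (hTi.const_mul _)) ?_
    filter_upwards [h.fermi_nonneg, hG.ae_eq_zero_of_fermi hε] with w hF hF0
    set z := v - w with hz
    set k := (fermi ε g w)⁻¹ • G w with hk
    have hGk : G w = fermi ε g w • k := by
      by_cases h0 : fermi ε g w = 0
      · rw [hF0 h0, h0, zero_smul]
      · rw [hk, smul_smul, mul_inv_cancel₀ h0, one_smul]
    have e1 : l ^ 2 * ‖perp u z‖ ^ 2 = wedgeSq z x := by
      rw [norm_perp_sq hu, hxu, wedgeSq_smul]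
    have e2 : l * inner ℝ k (scaledProj z u) = inner ℝ k (scaledProj z x) := by
      rw [hxu, scaledProj_smul, inner_smul_right]
    have e3 := wedgeSq_sub z x k
    have e4 := wedgeSq_nonneg z k
    have hχ0 : 0 ≤ cutoff hR w := (cutoff hR).nonneg
    have e5 : fermi ε g w * cutoff hR w * wedgeSq z (x - k) ≤ D w := by
      by_cases hw : w ∈ closedBall (0 : V) (2 * R)
      · rw [hD, Set.indicator_of_mem hw, productionDensity, norm_sq_mul_orthProj, mul_assoc]
        refine mul_le_mul_of_nonneg_left ?_ hF
        exact mul_le_of_le_one_left (wedgeSq_nonneg _ _) (cutoff hR).le_one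
      · rw [hD, Set.indicator_of_notMem hw, cutoff_eq_zero hR hw]
        simp
    change l ^ 2 * (fermi ε g w * cutoff hR w * ‖perp u z‖ ^ 2) ≤
      D w + 2 * l * inner ℝ (G w) (testField hR v u w)
    rw [testField, ← hz, hGk, inner_smul_right, inner_smul_left]
    simp only [conj_trivial]
    have e6 : l ^ 2 * (fermi ε g w * cutoff hR w * ‖perp u z‖ ^ 2) =
        fermi ε g w * cutoff hR w * wedgeSq z x := by rw [← e1]; ring
    have e7 : 2 * l * (cutoff hR w * (fermi ε g w * inner ℝ k (scaledProj z u))) =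
        fermi ε g w * cutoff hR w * (2 * inner ℝ k (scaledProj z x)) := by rw [← e2]; ring
    rw [e6, e7]
    have e8 : 0 ≤ fermi ε g w * cutoff hR w * wedgeSq z k := by positivity
    have e9 : fermi ε g w * cutoff hR w * wedgeSq z (x - k) =
        fermi ε g w * cutoff hR w * wedgeSq z x -
          fermi ε g w * cutoff hR w * (2 * inner ℝ k (scaledProj z x)) +
          fermi ε g w * cutoff hR w * wedgeSq z k := by rw [e3]; ring
    linarith
  have hA0 : 0 ≤ A := norm_nonneg _
  set N := 1 + ‖v‖ with hN
  have hN0 : 1 ≤ N := by linarith [norm_nonneg v]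
  have hZ' : Z ≤ K * (N * (1 + A)) := by
    refine (le_abs_self _).trans (hT.trans (le_of_eq ?_)); ring
  have hN2 : N ^ 2 ≤ 2 * (1 + ‖v‖ ^ 2) := by
    rw [hN]; nlinarith [sq_nonneg (1 - ‖v‖)]
  set a := l * (1 + A) with ha
  have hq1 : c₁ * a ^ 2 ≤ J + 2 * K * N * a := by
    have t1 : l ^ 2 * (c₁ * (1 + A) ^ 2) ≤ l ^ 2 * Q := by gcongr
    have t2 : 2 * l * Z ≤ 2 * l * (K * (N * (1 + A))) := by gcongr
    have t3 : c₁ * a ^ 2 = l ^ 2 * (c₁ * (1 + A) ^ 2) := by rw [ha]; ring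
    have t4 : 2 * K * N * a = 2 * l * (K * (N * (1 + A))) := by rw [ha]; ring
    linarith
  -- Young's inequality for `a = l (1 + A)`, which absorbs the linear term into half of `c₁ a²` and
  -- leaves only `N²`, of order `1 + |v|²`.
  have hq2 : 2 * K * N * a ≤ c₁ / 2 * a ^ 2 + 2 * K ^ 2 * N ^ 2 / c₁ := by
    have t1 : 0 ≤ (c₁ * a - 2 * K * N) ^ 2 / (2 * c₁) := by positivity
    have t2 : (c₁ * a - 2 * K * N) ^ 2 / (2 * c₁) =
        c₁ / 2 * a ^ 2 - 2 * K * N * a + 2 * K ^ 2 * N ^ 2 / c₁ := by field_simp; ring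
    linarith
  have hla : l ^ 2 ≤ a ^ 2 := by
    have : l ≤ a := le_mul_of_one_le_right hl0.le (by linarith)
    gcongr
  have hq3 : a ^ 2 ≤ 2 / c₁ * J + 4 * K ^ 2 / c₁ ^ 2 * N ^ 2 := by
    have t1 : c₁ / 2 * a ^ 2 ≤ J + 2 * K ^ 2 * N ^ 2 / c₁ := by linarith
    have t2 : a ^ 2 = 2 / c₁ * (c₁ / 2 * a ^ 2) := by field_simp
    rw [t2]
    have t3 : 2 / c₁ * (c₁ / 2 * a ^ 2) ≤ 2 / c₁ * (J + 2 * K ^ 2 * N ^ 2 / c₁) := by gcongr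
    refine t3.trans (le_of_eq ?_)
    field_simp; ring
  have hq4 : 4 * K ^ 2 / c₁ ^ 2 * N ^ 2 ≤ 4 * K ^ 2 / c₁ ^ 2 * (2 * (1 + ‖v‖ ^ 2)) := by gcongr
  have hq5 : 0 ≤ 2 / c₁ * (1 + ‖v‖ ^ 2) := by positivity
  have hq6 : 0 ≤ 8 * K ^ 2 / c₁ ^ 2 * J := by positivity
  have hq7 : 4 * K ^ 2 / c₁ ^ 2 * (2 * (1 + ‖v‖ ^ 2)) = 8 * K ^ 2 / c₁ ^ 2 * (1 + ‖v‖ ^ 2) := by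
    ring
  have hq8 : (2 / c₁ + 8 * K ^ 2 / c₁ ^ 2) * ((1 + ‖v‖ ^ 2) + J) =
      2 / c₁ * (1 + ‖v‖ ^ 2) + 2 / c₁ * J + 8 * K ^ 2 / c₁ ^ 2 * (1 + ‖v‖ ^ 2) +
        8 * K ^ 2 / c₁ ^ 2 * J := by ring
  rw [hq8]
  linarith

/-! ### Entropy bound for the class `Y_ε` -/

theorem fermiDiracS_eq (ε : ℝ) (f : V → ℝ) :
    fermiDiracS ε f = ∫ v, entropyDensity ε (f v) := by
  unfold fermiDiracS entropyDensity
  rw [integral_const_mul]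

theorem entropyDensity_eq {ε x : ℝ} (hε : 0 < ε) (hx : 0 ≤ x) :
    entropyDensity ε x = Real.log ε⁻¹ * x - x * Real.log x +
      ε⁻¹ * -((1 - ε * x) * Real.log (1 - ε * x)) := by
  rcases hx.eq_or_lt with rfl | hx
  · simp [entropyDensity]
  unfold entropyDensity
  rw [Real.log_mul hε.ne' hx.ne', Real.log_inv]
  field_simp
  ring

theorem IsInitialDatum.le_inv {ε₀ : ℝ} {f : V → ℝ} (h : IsInitialDatum ε₀ f) (hε₀ : 0 < ε₀) :
    ∀ᵐ v, f v ≤ ε₀⁻¹ := by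
  have h1 := ae_le_eLpNormEssSup (f := f) (μ := (volume : Measure V))
  rw [← eLpNorm_exponent_top, h.norm_eq] at h1
  filter_upwards [h1] with v hv
  rw [← ofReal_norm, ENNReal.ofReal_le_ofReal_iff (by positivity)] at hv
  exact (le_abs_self _).trans hv

/-- The contribution of `-(1 - ε f) log (1 - ε f)` is nonnegative and is dropped; the rest
integrates exactly because the mass is `1`. -/
theorem IsInitialDatum.le_fermiDiracS {ε₀ ε : ℝ} {f : V → ℝ} (h : IsInitialDatum ε₀ f)
    (hn : IsNormalized f) (hε : 0 < ε) (hεε₀ : ε ≤ ε₀) :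
    Real.log ε⁻¹ - boltzmannH f ≤ fermiDiracS ε f := by
  have hε₀ : 0 < ε₀ := hε.trans_le hεε₀
  have hf := h.memL1.1
  have hi := (hf.const_mul (Real.log ε⁻¹)).sub h.integrable_log
  have hbd : ∀ᵐ v, 0 ≤ ε⁻¹ * -((1 - ε * f v) * Real.log (1 - ε * f v)) ∧
      ε⁻¹ * -((1 - ε * f v) * Real.log (1 - ε * f v)) ≤ f v := by
    filter_upwards [h.nonneg, h.le_inv hε₀] with v h0 h1
    have h2 : ε * f v ≤ 1 := by
      calc ε * f v ≤ ε₀ * ε₀⁻¹ := by gcongr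
        _ = 1 := mul_inv_cancel₀ hε₀.ne'
    have h3 : 0 ≤ ε * f v := by positivity
    refine ⟨mul_nonneg (by positivity) (neg_nonneg.2 (mul_nonpos_of_nonneg_of_nonpos
      (by linarith) (Real.log_nonpos (by linarith) (by linarith)))), ?_⟩
    have h4 : ε⁻¹ * -((1 - ε * f v) * Real.log (1 - ε * f v)) ≤ ε⁻¹ * (ε * f v) := by
      gcongr
      exact neg_one_sub_mul_log_le h2
    rwa [inv_mul_cancel_left₀ hε.ne'] at h4
  have hr : Integrable fun v => ε⁻¹ * -((1 - ε * f v) * Real.log (1 - ε * f v)) := by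
    refine hf.mono' ?_ ?_
    · have hm : Measurable fun x : ℝ => ε⁻¹ * -((1 - ε * x) * Real.log (1 - ε * x)) := by fun_prop
      exact (hm.comp_aemeasurable hf.aemeasurable).aestronglyMeasurable
    · filter_upwards [hbd] with v hv
      rw [Real.norm_of_nonneg hv.1]
      exact hv.2
  rw [fermiDiracS_eq]
  have e : ∫ v, entropyDensity ε (f v) = ∫ v, ((Real.log ε⁻¹ * f v - f v * Real.log (f v)) +
      ε⁻¹ * -((1 - ε * f v) * Real.log (1 - ε * f v))) := by
    refine integral_congr_ae ?_
    filter_upwards [h.nonneg] with v h0 using entropyDensity_eq hε h0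
  have hi' : Integrable fun v => Real.log ε⁻¹ * f v - f v * Real.log (f v) := hi
  rw [e, integral_add hi' hr, integral_sub (hf.const_mul _) h.integrable_log,
    integral_const_mul, hn.mass, mul_one]
  have : 0 ≤ ∫ v, ε⁻¹ * -((1 - ε * f v) * Real.log (1 - ε * f v)) :=
    integral_nonneg_of_ae (by filter_upwards [hbd] with v hv using hv.1)
  unfold boltzmannH
  linarith

/-- The positivity of the entropy yields a strict bound on the Boltzmann entropy. -/
theorem IsInitialDatum.boltzmannH_lt {ε₀ : ℝ} {f : V → ℝ} (h : IsInitialDatum ε₀ f)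
    (hn : IsNormalized f) (hε₀ : 0 < ε₀) : boltzmannH f < Real.log ε₀⁻¹ := by
  by_contra hcon
  rw [not_lt] at hcon
  have hf := h.memL1.1
  have hi : Integrable fun v => Real.log ε₀⁻¹ * f v - f v * Real.log (f v) :=
    (hf.const_mul _).sub h.integrable_log
  have hp : ∀ᵐ v, 0 ≤ Real.log ε₀⁻¹ * f v - f v * Real.log (f v) := by
    filter_upwards [h.nonneg, h.le_inv hε₀] with v h0 h1
    rcases h0.eq_or_lt with h2 | h2
    · simp [← h2]
    · have := Real.log_le_log h2 h1
      nlinarith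
  have hint : ∫ v, (Real.log ε₀⁻¹ * f v - f v * Real.log (f v)) = Real.log ε₀⁻¹ - boltzmannH f := by
    rw [integral_sub (hf.const_mul _) h.integrable_log, integral_const_mul, hn.mass, mul_one]
    rfl
  -- The equality case: the nonnegative integrand `f log (ε₀⁻¹ / f)` has zero integral, so `f` takes
  -- only the values `0` and `ε₀⁻¹`, on which the entropy density vanishes.
  have h0 : ∫ v, (Real.log ε₀⁻¹ * f v - f v * Real.log (f v)) = 0 :=
    le_antisymm (by linarith) (integral_nonneg_of_ae hp)
  rw [integral_eq_zero_iff_of_nonneg_ae hp hi] at h0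
  have hS : fermiDiracS ε₀ f = 0 := by
    rw [fermiDiracS_eq]
    refine integral_eq_zero_of_ae ?_
    filter_upwards [h0, h.nonneg] with v hv h1
    simp only [Pi.zero_apply] at hv ⊢
    rcases h1.eq_or_lt with h2 | h2
    · simp [entropyDensity, ← h2]
    · have h3 : f v * (Real.log ε₀⁻¹ - Real.log (f v)) = 0 := by linarith
      have h4 : Real.log ε₀⁻¹ = Real.log (f v) := by
        rcases mul_eq_zero.1 h3 with h5 | h5
        · exact absurd h5 h2.ne'
        · linarith
      have h5 : ε₀⁻¹ = f v := Real.log_injOn_pos (Set.mem_Ioi.2 (by positivity)) h2 h4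
      simp [entropyDensity, ← h5, mul_inv_cancel₀ hε₀.ne']
  exact h.entropy_pos.ne' hS

theorem bracket_rpow_two (v : V) : bracket v ^ (2 : ℝ) = 1 + ‖v‖ ^ 2 := by
  rw [bracket, Real.rpow_two, Real.sq_sqrt (by positivity)]

/-- `S_ε(f_in) ≥ log ε⁻¹ - H(f_in)`, and `log ε⁻¹` exceeds `log ε₀⁻¹` by exactly the subtracted `log
(ε₀ / ε)`. The resulting bound depends only on `ε₀` and `H(f_in)`. -/
theorem ClassY.hasEntropyBound {ε₀ ε : ℝ} {f g : V → ℝ} (hg : ClassY ε f g)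
    (h : IsInitialDatum ε₀ f) (hn : IsNormalized f) (hε : 0 < ε) (hεε₀ : ε ≤ ε₀) :
    HasEntropyBound ε₀ (Real.log ε₀⁻¹ - boltzmannH f) ε g := by
  have hε₀ : 0 < ε₀ := hε.trans_le hεε₀
  have hgi := hg.memL1.1
  have hmass : ∫ v, g v = 1 := hg.mass.trans hn.mass
  refine ⟨hgi, hg.nonneg, ?_, hmass, ?_, hg.energy.trans hn.energy, ?_⟩
  · filter_upwards [hg.le_inv] with v hv
    calc ε * g v ≤ ε * ε⁻¹ := by gcongr
      _ = 1 := mul_inv_cancel₀ hε.ne'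
  · refine hg.memL1.2.mono' (hgi.aestronglyMeasurable.mul
      (continuous_norm.pow 2).aestronglyMeasurable) (Eventually.of_forall fun v => ?_)
    rw [bracket_rpow_two, norm_mul, Real.norm_eq_abs, Real.norm_of_nonneg (by positivity)]
    nlinarith [abs_nonneg (g v)]
  · have h1 := (h.le_fermiDiracS hn hε hεε₀).trans hg.entropy
    have h2 := h.boltzmannH_lt hn hε₀
    have h3 : Real.log ε⁻¹ = Real.log ε₀⁻¹ + Real.log (ε₀ / ε) := by
      rw [← Real.log_mul (by positivity) (by positivity)]
      congr 1; field_simp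
    have h4 : 0 ≤ Real.log (ε₀ / ε) := Real.log_nonneg (by rwa [one_le_div hε])
    rw [fermiDiracS_eq ε g] at h1
    have hi : Integrable fun v => entropyDensity ε (g v) := by
      by_contra hni
      rw [integral_undef hni] at h1
      linarith
    rw [integral_sub hi (hgi.const_mul _), integral_const_mul, hmass]
    linarith

/-! ### Integration in `v` and comparison with the production -/

theorem one_le_bracket (v : V) : 1 ≤ bracket v :=
  Real.one_le_sqrt.2 (by nlinarith [sq_nonneg ‖v‖])

theorem norm_le_bracket (v : V) : ‖v‖ ≤ bracket v :=
  Real.le_sqrt_of_sq_le (by linarith)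

theorem continuous_bracket : Continuous bracket := by
  unfold bracket; fun_prop

theorem aemeasurable_orthProj {α : Type*} [MeasurableSpace α] {μ : Measure α} {f h : α → V}
    (hf : AEMeasurable f μ) (hh : AEMeasurable h μ) :
    AEMeasurable (fun a => orthProj (f a) (h a)) μ := by
  unfold orthProj
  exact hh.sub (((hf.inner hh).div (hf.norm.pow_const 2)).smul hf)

theorem measurable_kineticPotential (γ : ℝ) : Measurable (kineticPotential γ) := by
  unfold kineticPotential
  fun_prop

theorem aemeasurable_Xi {ε : ℝ} {g : V → ℝ} {G : V → V} (hg : AEMeasurable g volume)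
    (hG : AEMeasurable G volume) :
    AEMeasurable (fun p : V × V => Xi ε g G p.1 p.2) (volume.prod volume) := by
  have g1 : AEMeasurable (fun p : V × V => g p.1) (volume.prod volume) := hg.comp_fst
  have g2 : AEMeasurable (fun p : V × V => g p.2) (volume.prod volume) := hg.comp_snd
  have G1 : AEMeasurable (fun p : V × V => G p.1) (volume.prod volume) := hG.comp_fst
  have G2 : AEMeasurable (fun p : V × V => G p.2) (volume.prod volume) := hG.comp_snd
  have hd : AEMeasurable (fun p : V × V => p.1 - p.2) (volume.prod volume) :=
    (measurable_fst.sub measurable_snd).aemeasurable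
  have o1 : AEMeasurable (fun p : V × V => 1 - ε * g p.1) (volume.prod volume) :=
    (g1.const_mul ε).const_sub 1
  have o2 : AEMeasurable (fun p : V × V => 1 - ε * g p.2) (volume.prod volume) :=
    (g2.const_mul ε).const_sub 1
  unfold Xi
  exact (((g1.mul g2).mul o1).mul o2).mul ((aemeasurable_orthProj hd
    (((g1.mul o1).inv.smul G1).sub ((g2.mul o2).inv.smul G2))).norm.pow_const 2)

theorem aemeasurable_fermi {ε : ℝ} {g : V → ℝ} (hg : AEMeasurable g volume) :
    AEMeasurable (fermi ε g) volume := hg.mul ((hg.const_mul ε).const_sub 1)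

theorem aemeasurable_productionDensity {ε : ℝ} {g : V → ℝ} {G : V → V}
    (hg : AEMeasurable g volume) (hG : AEMeasurable G volume) (v x : V) :
    AEMeasurable (productionDensity ε g G v x) volume := by
  have hF := aemeasurable_fermi (ε := ε) hg
  have hd : AEMeasurable (fun w : V => v - w) volume := (measurable_id.const_sub v).aemeasurable
  unfold productionDensity
  exact hF.mul ((hd.norm.pow_const 2).mul ((aemeasurable_orthProj hd
    ((hF.inv.smul hG).const_sub x)).norm.pow_const 2))

/-- Comparison of the weighted production density with the integrand of the entropy
production. -/
theorem weight_mul_productionDensity_le {γ ε R : ℝ} (hγ : γ < 0) (hR : 0 < R) {g : V → ℝ}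
    {G : V → V} {v w : V} (hv : 0 ≤ fermi ε g v) (hF : 0 ≤ fermi ε g w) (hw : ‖w‖ ≤ 2 * R) :
    fermi ε g v * bracket v ^ γ * productionDensity ε g G v ((fermi ε g v)⁻¹ • G v) w ≤
      (1 + 2 * R) ^ (-γ) * (kineticPotential γ (v - w) * Xi ε g G v w) := by
  set o := ‖orthProj (v - w) ((fermi ε g v)⁻¹ • G v - (fermi ε g w)⁻¹ • G w)‖ ^ 2 with ho
  have ho0 : 0 ≤ o := by positivity
  have hXi : Xi ε g G v w = fermi ε g v * fermi ε g w * o := by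
    rw [ho]; unfold Xi fermi; ring
  have hpd : productionDensity ε g G v ((fermi ε g v)⁻¹ • G v) w =
      fermi ε g w * (‖v - w‖ ^ 2 * o) := rfl
  rw [hXi, hpd]
  have hb : 0 < bracket v := by linarith [one_le_bracket v]
  -- On the diagonal the factor `|v - w|²` kills the left side. Off it, `|v - w| ≤ (1 + 2R)⟨v⟩`, and
  -- a negative power reverses this.
  rcases (norm_nonneg (v - w)).eq_or_lt with hz | hz
  · rw [← hz]
    have : 0 ≤ kineticPotential γ (v - w) := Real.rpow_nonneg (norm_nonneg _) _
    have h2 : 0 ≤ (1 + 2 * R) ^ (-γ) * (kineticPotential γ (v - w) *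
      (fermi ε g v * fermi ε g w * o)) := by positivity
    simpa using h2
  · have hle : ‖v - w‖ ≤ (1 + 2 * R) * bracket v := by
      refine (norm_sub_le _ _).trans ?_
      nlinarith [norm_le_bracket v, one_le_bracket v]
    have h1 : (1 + 2 * R) ^ γ * bracket v ^ γ ≤ ‖v - w‖ ^ γ := by
      rw [← Real.mul_rpow (by positivity) hb.le]
      exact Real.rpow_le_rpow_of_nonpos hz hle hγ.le
    have h2 : bracket v ^ γ ≤ (1 + 2 * R) ^ (-γ) * ‖v - w‖ ^ γ := by
      calc bracket v ^ γ = (1 + 2 * R) ^ (-γ) * ((1 + 2 * R) ^ γ * bracket v ^ γ) := by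
            rw [← mul_assoc, ← Real.rpow_add (by positivity)]; simp
        _ ≤ _ := by gcongr
    have h3 : kineticPotential γ (v - w) = ‖v - w‖ ^ γ * ‖v - w‖ ^ 2 := by
      rw [kineticPotential, Real.rpow_add hz, Real.rpow_two]
    rw [h3]
    have h4 : 0 ≤ fermi ε g v * fermi ε g w * ‖v - w‖ ^ 2 * o := by positivity
    have h5 := mul_le_mul_of_nonneg_right h2 h4
    calc _ = bracket v ^ γ * (fermi ε g v * fermi ε g w * ‖v - w‖ ^ 2 * o) := by ring
      _ ≤ _ := h5
      _ = _ := by ring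

theorem norm_sqrtGrad_sq_le {ε : ℝ} (hε : 0 < ε) {g : V → ℝ} {G : V → V} {v : V}
    (hF : 0 < fermi ε g v) :
    ‖sqrtGrad g G v‖ ^ 2 ≤ fermi ε g v * ‖(fermi ε g v)⁻¹ • G v‖ ^ 2 := by
  have hg : fermi ε g v ≤ g v := fermi_le hε
  have hg0 : 0 < g v := hF.trans_le hg
  rw [sqrtGrad, norm_smul, norm_smul, mul_pow, mul_pow, ← mul_assoc]
  refine mul_le_mul_of_nonneg_right ?_ (by positivity)
  rw [norm_inv, norm_inv, Real.norm_of_nonneg hF.le, Real.norm_of_nonneg (by positivity),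
    inv_pow, mul_pow, Real.sq_sqrt hg0.le]
  have e : fermi ε g v * (fermi ε g v)⁻¹ ^ 2 = (fermi ε g v)⁻¹ := by field_simp
  rw [e]
  gcongr
  linarith

/-- The integrand of the entropy production. -/
def productionIntegrand (γ ε : ℝ) (g : V → ℝ) (G : V → V) (p : V × V) : ENNReal :=
  ENNReal.ofReal (kineticPotential γ (p.1 - p.2) * Xi ε g G p.1 p.2)

theorem ofReal_sqrtGrad_le {ε₀ s₀ ε γ R C : ℝ} (hγ : γ < 0) (hR : 0 < R) (hC : 0 < C)
    (hε : 0 < ε) {g : V → ℝ} {G : V → V} (h : HasEntropyBound ε₀ s₀ ε g)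
    (hG : IsWeakGradient g G) {v : V}
    (hx : IntegrableOn (productionDensity ε g G v ((fermi ε g v)⁻¹ • G v))
      (closedBall 0 (2 * R)) →
        ‖(fermi ε g v)⁻¹ • G v‖ ^ 2 ≤ C * ((1 + ‖v‖ ^ 2) + ∫ w in closedBall (0 : V) (2 * R),
          productionDensity ε g G v ((fermi ε g v)⁻¹ • G v) w))
    (hv : 0 ≤ fermi ε g v) (hv0 : fermi ε g v = 0 → G v = 0) :
    ENNReal.ofReal (‖sqrtGrad g G v‖ ^ 2 * bracket v ^ γ) ≤
      ENNReal.ofReal (C * (1 + (1 + 2 * R) ^ (-γ))) *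
        (ENNReal.ofReal (g v * (1 + ‖v‖ ^ 2)) + ∫⁻ w, productionIntegrand γ ε g G (v, w)) := by
  set m := (1 + 2 * R) ^ (-γ) with hm
  have hm0 : 0 < m := Real.rpow_pos_of_pos (by positivity) _
  set X := ∫⁻ w, productionIntegrand γ ε g G (v, w) with hX
  rcases hv.eq_or_lt with hF0 | hF
  · simp [sqrtGrad, hv0 hF0.symm]
  by_cases hXt : X = ⊤
  · rw [hXt, add_top, ENNReal.mul_top]
    · exact le_top
    · exact (ENNReal.ofReal_pos.2 (by positivity)).ne'
  have hb : 0 < bracket v := by linarith [one_le_bracket v]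
  set q := fermi ε g v * bracket v ^ γ with hq
  have hb1 : bracket v ^ γ ≤ 1 := Real.rpow_le_one_of_one_le_of_nonpos (one_le_bracket v) hγ.le
  have hb0 : 0 < bracket v ^ γ := Real.rpow_pos_of_pos hb _
  have hq0 : 0 < q := by positivity
  have hqg : q ≤ g v := by
    calc q ≤ fermi ε g v * 1 := by rw [hq]; gcongr
      _ ≤ g v := by rw [mul_one]; exact fermi_le hε
  set pd := productionDensity ε g G v ((fermi ε g v)⁻¹ • G v) with hpd
  set B := closedBall (0 : V) (2 * R) with hB
  have hpdm : AEMeasurable pd volume := aemeasurable_productionDensity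
    h.integrable.aemeasurable hG.locInt_grad.aestronglyMeasurable.aemeasurable v _
  have hpd0 : ∀ᵐ w ∂(volume.restrict B), 0 ≤ pd w := by
    refine ae_restrict_of_ae ?_
    filter_upwards [h.fermi_nonneg] with w hw
    exact mul_nonneg hw (by positivity)
  have hlin : ∫⁻ w in B, ENNReal.ofReal (q * pd w) ≤ ENNReal.ofReal m * X := by
    rw [hX, ← lintegral_const_mul' _ _ ENNReal.ofReal_ne_top]
    refine (lintegral_mono_ae ?_).trans (setLIntegral_le_lintegral B _)
    filter_upwards [ae_restrict_mem measurableSet_closedBall,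
      ae_restrict_of_ae h.fermi_nonneg] with w hwB hw
    rw [productionIntegrand, ← ENNReal.ofReal_mul hm0.le]
    exact ENNReal.ofReal_le_ofReal
      (weight_mul_productionDensity_le hγ hR hv hw (by simpa [hB] using hwB))
  have hfin : ENNReal.ofReal m * X ≠ ⊤ := ENNReal.mul_ne_top ENNReal.ofReal_ne_top hXt
  have hqi : IntegrableOn (fun w => q * pd w) B := by
    refine ⟨(hpdm.const_mul q).restrict.aestronglyMeasurable, ?_⟩
    rw [hasFiniteIntegral_iff_ofReal]
    · exact hlin.trans_lt hfin.lt_top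
    · filter_upwards [hpd0] with w hw using mul_nonneg hq0.le hw
  have hpdi : IntegrableOn pd B := by
    have := hqi.const_mul q⁻¹
    refine this.congr (Eventually.of_forall fun w => ?_)
    simp only
    rw [inv_mul_cancel_left₀ hq0.ne']
  have hmain := hx hpdi
  set J := ∫ w in B, pd w with hJ
  have hJ0 : 0 ≤ J := integral_nonneg_of_ae hpd0
  have hqJ : ENNReal.ofReal (q * J) ≤ ENNReal.ofReal m * X := by
    rw [hJ, ← integral_const_mul, ofReal_integral_eq_lintegral_ofReal hqi]
    · exact hlin
    · filter_upwards [hpd0] with w hw using mul_nonneg hq0.le hw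
  have hreal : ‖sqrtGrad g G v‖ ^ 2 * bracket v ^ γ ≤
      C * (g v * (1 + ‖v‖ ^ 2)) + C * (q * J) := by
    calc ‖sqrtGrad g G v‖ ^ 2 * bracket v ^ γ
        ≤ fermi ε g v * ‖(fermi ε g v)⁻¹ • G v‖ ^ 2 * bracket v ^ γ := by
          gcongr; exact norm_sqrtGrad_sq_le hε hF
      _ = q * ‖(fermi ε g v)⁻¹ • G v‖ ^ 2 := by rw [hq]; ring
      _ ≤ q * (C * ((1 + ‖v‖ ^ 2) + J)) := by gcongr
      _ = C * (q * (1 + ‖v‖ ^ 2)) + C * (q * J) := by ring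
      _ ≤ _ := by gcongr
  have hg0 : 0 ≤ g v := hq0.le.trans hqg
  refine (ENNReal.ofReal_le_ofReal hreal).trans ?_
  rw [ENNReal.ofReal_add (by positivity) (by positivity), ENNReal.ofReal_mul hC.le,
    ENNReal.ofReal_mul hC.le, mul_add (ENNReal.ofReal (C * (1 + m)))]
  refine add_le_add ?_ ?_
  · gcongr
    exact le_mul_of_one_le_right hC.le (by linarith)
  · calc ENNReal.ofReal C * ENNReal.ofReal (q * J)
        ≤ ENNReal.ofReal C * (ENNReal.ofReal m * X) := by gcongr
      _ = ENNReal.ofReal (C * m) * X := by rw [ENNReal.ofReal_mul hC.le, mul_assoc]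
      _ ≤ _ := by
        gcongr ENNReal.ofReal (C * ?_) * X
        linarith

/-- The weight is bounded below on compact sets, and `|G| ≤ 1 + |G|²`. -/
theorem locallyIntegrable_of_lintegral_lt_top {γ : ℝ} {G : V → V}
    (hm : AEStronglyMeasurable G volume)
    (h : ∫⁻ v, ENNReal.ofReal (‖G v‖ ^ 2 * bracket v ^ γ) < ⊤) : LocallyIntegrable G := by
  have hb0 : ∀ v, 0 < bracket v := fun v => by linarith [one_le_bracket v]
  have hi : Integrable fun v => ‖G v‖ ^ 2 * bracket v ^ γ := by
    refine ⟨(hm.norm.pow 2).mul (continuous_bracket.rpow_const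
      fun v => Or.inl (hb0 v).ne').aestronglyMeasurable, ?_⟩
    rw [hasFiniteIntegral_iff_ofReal]
    · exact h
    · exact Eventually.of_forall fun v => mul_nonneg (by positivity)
        (Real.rpow_nonneg (hb0 v).le _)
  have hc : Continuous fun v => bracket v ^ (-γ) :=
    continuous_bracket.rpow_const fun v => Or.inl (hb0 v).ne'
  have hs : LocallyIntegrable fun v => bracket v ^ (-γ) * (‖G v‖ ^ 2 * bracket v ^ γ) := by
    rw [locallyIntegrable_iff]
    exact fun K hK => (hi.integrableOn (s := K)).continuousOn_mul hc.continuousOn hK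
  refine ((locallyIntegrable_const (1 : ℝ)).add hs).mono hm (Eventually.of_forall fun v => ?_)
  have e : bracket v ^ (-γ) * (‖G v‖ ^ 2 * bracket v ^ γ) = ‖G v‖ ^ 2 := by
    rw [mul_comm (‖G v‖ ^ 2), ← mul_assoc, ← Real.rpow_add (hb0 v)]
    simp
  rw [Pi.add_apply, e, Real.norm_of_nonneg (by positivity)]
  nlinarith [sq_nonneg (‖G v‖ - 1)]

/-- The Fisher information is controlled by the entropy production computed with any weak
gradient. -/
theorem exists_fisherInformation_le {γ ε₀ s₀ : ℝ} (hγ : γ < 0) (hε₀ : 0 < ε₀) (hs₀ : 0 < s₀) :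
    ∃ C : ℝ, 0 < C ∧ ∀ ε : ℝ, ∀ g : V → ℝ, ∀ G : V → V, 0 < ε → ε ≤ ε₀ →
      HasEntropyBound ε₀ s₀ ε g → IsWeakGradient g G →
        fisherInformation γ g ≤
          ENNReal.ofReal C * (1 + (1 / 2 : ENNReal) * ∫⁻ p, productionIntegrand γ ε g G p) := by
  obtain ⟨R, C, hR1, hC, hmain⟩ := exists_norm_sq_le hε₀ hs₀
  have hR : 0 < R := by linarith
  have hm0 : 0 < (1 + 2 * R) ^ (-γ) := Real.rpow_pos_of_pos (by positivity) _
  set C' := C * (1 + (1 + 2 * R) ^ (-γ)) with hC'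
  have hC'0 : 0 < C' := by positivity
  refine ⟨C' * 4, by positivity, fun ε g G hε hεε₀ h hG => ?_⟩
  set Y := ∫⁻ p, productionIntegrand γ ε g G p with hY
  have hmeas : AEMeasurable (productionIntegrand γ ε g G) (volume.prod volume) := by
    refine AEMeasurable.ennreal_ofReal (AEMeasurable.mul ?_ (aemeasurable_Xi
      h.integrable.aemeasurable hG.locInt_grad.aestronglyMeasurable.aemeasurable))
    exact ((measurable_kineticPotential γ).comp
      (measurable_fst.sub measurable_snd)).aemeasurable
  have hgm : AEMeasurable (fun v => ENNReal.ofReal (g v * (1 + ‖v‖ ^ 2))) volume :=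
    h.integrable_bracket.aemeasurable.ennreal_ofReal
  have hg4 : ∫⁻ v, ENNReal.ofReal (g v * (1 + ‖v‖ ^ 2)) = 4 := by
    rw [← ofReal_integral_eq_lintegral_ofReal h.integrable_bracket, h.integral_bracket]
    · norm_num
    · filter_upwards [h.nonneg] with v hv using mul_nonneg hv (by positivity)
  have hbound : ∫⁻ v, ENNReal.ofReal (‖sqrtGrad g G v‖ ^ 2 * bracket v ^ γ) ≤
      ENNReal.ofReal (C' * 4) * (1 + (1 / 2 : ENNReal) * Y) := by
    calc ∫⁻ v, ENNReal.ofReal (‖sqrtGrad g G v‖ ^ 2 * bracket v ^ γ)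
        ≤ ∫⁻ v, ENNReal.ofReal C' * (ENNReal.ofReal (g v * (1 + ‖v‖ ^ 2)) +
            ∫⁻ w, productionIntegrand γ ε g G (v, w)) := by
          refine lintegral_mono_ae ?_
          filter_upwards [h.fermi_nonneg, hG.ae_eq_zero_of_fermi hε] with v hv hv0
          exact ofReal_sqrtGrad_le hγ hR hC hε h hG (hmain ε g G hε hεε₀ h hG v _) hv hv0
      _ = ENNReal.ofReal C' * (4 + Y) := by
          rw [lintegral_const_mul' _ _ ENNReal.ofReal_ne_top, lintegral_add_left' hgm, hg4, hY,
            Measure.volume_eq_prod, lintegral_prod _ hmeas]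
      _ ≤ ENNReal.ofReal C' * (4 * (1 + (1 / 2 : ENNReal) * Y)) := by
          gcongr
          rw [mul_add, mul_one, ← mul_assoc]
          gcongr
          refine le_mul_of_one_le_left zero_le ?_
          rw [show (4 : ENNReal) = 2 * 2 by norm_num, mul_assoc, one_div,
            ENNReal.mul_inv_cancel two_ne_zero ENNReal.ofNat_ne_top]
          norm_num
      _ = _ := by
          rw [ENNReal.ofReal_mul hC'0.le, ← mul_assoc]
          norm_num
  -- `sqrtGrad` is known to be locally integrable, hence the weak gradient of `√g`, only when the
  -- production is finite; otherwise the bound is trivial.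
  by_cases hYt : Y = ⊤
  · rw [hYt, ENNReal.mul_top (by simp), add_top, ENNReal.mul_top]
    · exact le_top
    · exact (ENNReal.ofReal_pos.2 (by positivity)).ne'
  have hlt : ∫⁻ v, ENNReal.ofReal (‖sqrtGrad g G v‖ ^ 2 * bracket v ^ γ) < ⊤ := by
    refine hbound.trans_lt (ENNReal.mul_lt_top ENNReal.ofReal_lt_top ?_)
    exact ENNReal.add_lt_top.2 ⟨ENNReal.one_lt_top,
      ENNReal.mul_lt_top (by simp) (lt_top_iff_ne_top.2 hYt)⟩
  have hsm : AEStronglyMeasurable (sqrtGrad g G) volume := by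
    have h1 : AEMeasurable (fun v => (2 * Real.sqrt (g v))⁻¹) volume :=
      (h.integrable.aemeasurable.sqrt.const_mul 2).inv
    exact h1.aestronglyMeasurable.smul hG.locInt_grad.aestronglyMeasurable
  have hw := hG.sqrt h.nonneg (locallyIntegrable_of_lintegral_lt_top hsm hlt)
  exact (iInf₂_le (sqrtGrad g G) hw).trans hbound

end LFD

end

theorem theorem1p8 (γ : ℝ) (hγ : γ < 0) (ε₀ : ℝ) (hε₀ : 0 < ε₀) (H₀ : ℝ) :
    ∃ C : ℝ, 0 < C ∧
      ∀ fin : LFD.V → ℝ, LFD.IsInitialDatum ε₀ fin → LFD.IsNormalized fin →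
        LFD.boltzmannH fin = H₀ →
        ∀ ε : ℝ, 0 < ε → ε ≤ ε₀ →
          ∀ g : LFD.V → ℝ, LFD.ClassY ε fin g →
            LFD.fisherInformation γ g ≤
              ENNReal.ofReal C * (1 + LFD.entropyProduction γ ε g) := by
  -- The constant is chosen from `s₀ = log ε₀⁻¹ - H₀`. If this is not positive, no initial datum has
  -- `H(f_in) = H₀`, and any constant serves.
  by_cases hH : H₀ < Real.log ε₀⁻¹
  · obtain ⟨C, hC, hmain⟩ := LFD.exists_fisherInformation_le hγ hε₀ (sub_pos.2 hH)
    refine ⟨C, hC, fun fin hf hn hfH ε hε hεε₀ g hg => ?_⟩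
    have h := hg.hasEntropyBound hf hn hε hεε₀
    rw [hfH] at h
    have hC0 : ENNReal.ofReal C ≠ 0 := (ENNReal.ofReal_pos.2 hC).ne'
    -- Isolating the infimum over weak gradients turns the claim into a lower bound for each
    -- gradient; without any weak gradient the infimum is `∞`.
    rw [mul_comm, ← ENNReal.div_le_iff_le_mul (Or.inl hC0) (Or.inl ENNReal.ofReal_ne_top),
      ← tsub_le_iff_left]
    refine le_iInf₂ fun G hG => ?_
    rw [tsub_le_iff_left, ENNReal.div_le_iff_le_mul (Or.inl hC0) (Or.inl ENNReal.ofReal_ne_top),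
      mul_comm]
    exact hmain ε g G hε hεε₀ h hG
  · exact ⟨1, one_pos, fun fin hf hn hfH => absurd (hfH ▸ hf.boltzmannH_lt hn hε₀) hH⟩
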